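/- Let $S$ be a closed, connected, oriented (smooth) surface of genus $g\ge 0$, presented as a $4g$-gon whose sides are identified in the usual way according to the boundary word $x_1y_1x_1^{-1}y_1^{-1}\cdots x_gy_gx_g^{-1}y_g^{-1}$ (for $g=0$: a disc whose boundary is collapsed to a point), so that $x_1,y_1,\dots,x_g,y_g$ are loops in $S$ with a common base point. Let $\ell$ be an oriented link in $S\times[0,1]$ whose projection to $S$ is a generic immersion (its multiple points are finitely many transverse double points), and let $\mathcal D$ be the resulting oriented diagram, the strand with the larger $[0,1]$-coordinate being the overcrossing one. Assume that $\mathcal D$ is in general position with respect to the loops: each loop meets $\mathcal D$ in finitely many points, transversely, away from the crossings of $\mathcal D$ and from the base point. The *Wirtinger link group* $\pi_{wirt}$ has the arcs of $\mathcal D$ as generators and one relation $ab=ca$ for each crossing, where $a$ is the overcrossing arc and $b$, $c$ are the undercrossing arcs on the left and on the right of $a$, respectively. The *Dehn link group* $\pi_{dehn}$ has the regions of $\mathcal D$ (the components of the complement in $S$ of the projection of $\ell$) as generators, an arbitrarily chosen base region $R_0$ being set equal to $1$, and one relation $A^{-1}B=C^{-1}D$ for each crossing, where $A$ (right) and $B$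 (left) are the regions separated by the overcrossing arc just after the crossing, and $C$ (right) and $D$ (left) those separated by it just before the crossing. For a path $\gamma$ in general position with respect to $\mathcal D$, let $\int_\gamma\mathcal D=a_1^{\epsilon_1}\cdots a_m^{\epsilon_m}\in\pi_{wirt}$, where $a_1,\dots,a_m$ are the arcs that $\gamma$ crosses, in this order, and $\epsilon_i=1$ if $\gamma$ crosses $a_i$ from its right to its left side, $\epsilon_i=-1$ otherwise. The *surface subgroup* $\pi_{wirt}^S$ is the normal subgroup of $\pi_{wirt}$ generated by $\int_{x_1}\mathcal D,\int_{y_1}\mathcal D,\dots,\int_{x_g}\mathcal D,\int_{y_g}\mathcal D$. Then $\pi_{dehn}\cong\pi_{wirt}/\pi_{wirt}^S$. More precisely, there is an isomorphism $\pi_{dehn}\to\pi_{wirt}/\pi_{wirt}^S$ that maps $A^{-1}B$ to the class of $a$ whenever $A$ and $B$ are the regions on the right and on the left of the arc $a$ at a point of $a$ that is not a crossing. -/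

import Mathlib

open scoped Manifold ContDiff Topology

noncomputable section

namespace ThickenedSurface

/-- The plane on which surfaces are modelled. -/
abbrev Plane : Type := EuclideanSpace ℝ (Fin 2)

/-- The determinant of the pair `(v, w)`; it is positive exactly when `w` points to the left of
`v`. -/
def cross (v w : Plane) : ℝ := v 0 * w 1 - v 1 * w 0

/-- The atlas of the surface `S` is oriented: all coordinate changes have positive Jacobian. -/
def IsOrientedAtlas (S : Type*) [TopologicalSpace S] [ChartedSpace Plane S] : Prop :=
  ∀ e ∈ atlas Plane S, ∀ e' ∈ atlas Plane S, ∀ z ∈ (e.symm ≫ₕ e').source,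
    0 < (fderiv ℝ (e.symm ≫ₕ e') z).det

/-- The velocity at time `t` of a curve in `S`, read in the preferred chart at `c t`. -/
def curveVelocity {S : Type*} [TopologicalSpace S] [ChartedSpace Plane S] (c : ℝ → S) (t : ℝ) :
    Plane :=
  deriv (fun s : ℝ => chartAt Plane (c t) (c s)) t

/-- An oriented link with `n` components in `S × [0,1]`: `n` disjoint embedded oriented circles
(the parameter circles are compact, so a continuous injection is an embedding). -/
structure OrientedLink (S : Type*) [TopologicalSpace S] (n : ℕ) where
  toFun : Fin n × UnitAddCircle → S × unitInterval
  continuous_toFun : Continuous toFun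
  injective_toFun : Function.Injective toFun

namespace OrientedLink

variable {S : Type*} [TopologicalSpace S] {n : ℕ} (L : OrientedLink S n)

/-- The projection of the link to the surface. -/
def proj (θ : Fin n × UnitAddCircle) : S := (L.toFun θ).1

/-- The height of a point of the link. -/
def height (θ : Fin n × UnitAddCircle) : unitInterval := (L.toFun θ).2

/-- The 4-valent graph underlying the diagram ("universe"): the image of the link in the surface. -/
def underlyingGraph : Set S := Set.range L.proj

/-- Travel for time `s` along the component of `θ`. -/
def shift (θ : Fin n × UnitAddCircle) (s : ℝ) : Fin n × UnitAddCircle :=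
  (θ.1, θ.2 + (s : UnitAddCircle))

/-- The strands at the parameters `o` and `u` cross, `o` above `u`. -/
def IsCrossing (o u : Fin n × UnitAddCircle) : Prop :=
  L.proj o = L.proj u ∧ L.height u < L.height o

/-- `θ` is the parameter of an undercrossing. -/
def IsUnder (θ : Fin n × UnitAddCircle) : Prop := ∃ o, L.IsCrossing o θ

/-- `θ` is not the parameter of a crossing. -/
def IsSimplePoint (θ : Fin n × UnitAddCircle) : Prop := ∀ θ', L.proj θ' = L.proj θ → θ' = θ

/-- The arcs of the diagram: the pieces into which the link is broken at the undercrossings.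
A component without undercrossings is a single (closed) arc. -/
def Arc : Type := ConnectedComponents {θ : Fin n × UnitAddCircle // ¬ L.IsUnder θ}

/-- The regions of the diagram: the components of the complement of the underlying graph. -/
def Region : Type _ := ConnectedComponents {p : S // p ∉ L.underlyingGraph}

/-- The point with parameter `θ` lies on the arc `a`. -/
def OnArc (θ : Fin n × UnitAddCircle) (a : L.Arc) : Prop :=
  ∃ h : ¬ L.IsUnder θ, ConnectedComponents.mk ⟨θ, h⟩ = a

/-- The point `p` lies in the region `R`. -/
def InRegion (p : S) (R : L.Region) : Prop :=
  ∃ h : p ∉ L.underlyingGraph, ConnectedComponents.mk ⟨p, h⟩ = R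

/-- The arc `a` is the one met just after (`d > 0`) or just before (`d < 0`) the parameter `θ`. -/
def ArcNext (θ : Fin n × UnitAddCircle) (d : ℝ) (a : L.Arc) : Prop :=
  ∀ᶠ ε : ℝ in 𝓝[>] 0, L.OnArc (shift θ (d * ε)) a

variable [ChartedSpace Plane S]

/-- The region `R` is the one met when leaving `p` in the direction `v`. -/
def RegionNext (p : S) (v : Plane) (R : L.Region) : Prop :=
  ∀ᶠ ε : ℝ in 𝓝[>] 0, L.InRegion ((chartAt Plane p).symm (chartAt Plane p p + ε • v)) R

/-- The velocity of the projected link, read in the preferred chart at the projected point. -/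
def velocity (θ : Fin n × UnitAddCircle) : Plane :=
  curveVelocity (fun s : ℝ => L.proj (shift θ s)) 0

/-- The link projects to a diagram: the projection is a smooth immersion whose multiple points are
finitely many transverse double points. -/
structure InGeneralPosition : Prop where
  smooth : ∀ i : Fin n,
    ContMDiff 𝓘(ℝ, ℝ) (𝓡 2) ∞ (fun s : ℝ => L.proj (i, (s : UnitAddCircle)))
  immersion : ∀ θ, L.velocity θ ≠ 0
  transverse : ∀ θ θ', θ ≠ θ' → L.proj θ = L.proj θ' → cross (L.velocity θ) (L.velocity θ') ≠ 0
  no_triple : ∀ θ₁ θ₂ θ₃, L.proj θ₁ = L.proj θ₂ → L.proj θ₂ = L.proj θ₃ →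
    θ₁ = θ₂ ∨ θ₂ = θ₃ ∨ θ₁ = θ₃
  finite_crossings : {θ | ¬ L.IsSimplePoint θ}.Finite

/-- The sign of a crossing: `1` if the lower strand passes from the right to the left of the upper
strand, `-1` if it passes from the left to the right. -/
def crossingSign (o u : Fin n × UnitAddCircle) : ℝ :=
  (SignType.sign (cross (L.velocity o) (L.velocity u)) : ℝ)

/-- The Wirtinger relators `(a b) (c a)⁻¹`, one for each crossing: `a` is the overcrossing arc,
`b` is the arc of the lower strand on the left of `a`, and `c` the one on the right of `a`. -/
def wirtingerRels : Set (FreeGroup L.Arc) :=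
  {r | ∃ (o u : Fin n × UnitAddCircle) (a b c : L.Arc), L.IsCrossing o u ∧ L.OnArc o a ∧
    L.ArcNext u (L.crossingSign o u) b ∧ L.ArcNext u (-L.crossingSign o u) c ∧
    r = (FreeGroup.of a * FreeGroup.of b) * (FreeGroup.of c * FreeGroup.of a)⁻¹}

/-- The Wirtinger link group. -/
abbrev WirtingerGroup : Type := PresentedGroup L.wirtingerRels

/-- The Dehn relators `(A⁻¹ B) (C⁻¹ D)⁻¹`, one for each crossing: the regions `A` (on the right)
and `B` (on the left) are separated by the overcrossing arc after the crossing, and `C` (on the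
right) and `D` (on the left) are separated by it before the crossing. -/
def crossingRels : Set (FreeGroup L.Region) :=
  {r | ∃ (o u : Fin n × UnitAddCircle) (A B C D : L.Region), L.IsCrossing o u ∧
    L.RegionNext (L.proj o) (L.velocity o - L.crossingSign o u • L.velocity u) A ∧
    L.RegionNext (L.proj o) (L.velocity o + L.crossingSign o u • L.velocity u) B ∧
    L.RegionNext (L.proj o) (-L.velocity o - L.crossingSign o u • L.velocity u) C ∧
    L.RegionNext (L.proj o) (-L.velocity o + L.crossingSign o u • L.velocity u) D ∧
    r = ((FreeGroup.of A)⁻¹ * FreeGroup.of B) * ((FreeGroup.of C)⁻¹ * FreeGroup.of D)⁻¹}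

/-- The Dehn link group with base region `R₀`, whose generator is set equal to the identity. -/
abbrev DehnGroup (R₀ : L.Region) : Type _ :=
  PresentedGroup (L.crossingRels ∪ {FreeGroup.of R₀})

/-- `w` is the result of integrating the diagram along `c : [0,1] → S`: list in increasing order
the times at which `c` meets the graph, and multiply, from left to right, the generators of the
arcs that are crossed, with exponent `1` when `c` crosses from right to left and `-1` when it
crosses from left to right. For a curve in general position there is exactly one such `w`. -/
def IsIntegral (c : ℝ → S) (w : L.WirtingerGroup) : Prop :=
  ∃ l : List (ℝ × (Fin n × UnitAddCircle) × L.Arc),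
    (l.map Prod.fst).Pairwise (· < ·) ∧
    (∀ t : ℝ, t ∈ l.map Prod.fst ↔ t ∈ Set.Icc (0 : ℝ) 1 ∧ c t ∈ L.underlyingGraph) ∧
    (∀ x ∈ l, L.proj x.2.1 = c x.1 ∧ L.OnArc x.2.1 x.2.2) ∧
    w = (l.map fun x => (PresentedGroup.of x.2.2 : L.WirtingerGroup) ^
      (SignType.sign (cross (L.velocity x.2.1) (curveVelocity c x.1)) : ℤ)).prod

/-- The curve `c : [0,1] → S` is in general position with respect to the diagram: it meets the
underlying graph finitely often, at times in the open interval, away from the crossings, transversely. -/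
structure CurveInGeneralPosition (c : ℝ → S) : Prop where
  finite_times : {t : ℝ | t ∈ Set.Icc (0 : ℝ) 1 ∧ c t ∈ L.underlyingGraph}.Finite
  start_notMem : c 0 ∉ L.underlyingGraph
  end_notMem : c 1 ∉ L.underlyingGraph
  transverse : ∀ t ∈ Set.Ioo (0 : ℝ) 1, ∀ θ, L.proj θ = c t →
    L.IsSimplePoint θ ∧ cross (L.velocity θ) (curveVelocity c t) ≠ 0

end OrientedLink

/-- The closed disc, viewed as a polygon with curved sides. -/
abbrev Disc : Type := Metric.closedBall (0 : ℂ) 1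

/-- The boundary circle of the disc is divided into `4 g` sides, numbered `0, …, 4 g - 1`; this is
the point at time `t ∈ [0,1]` of side `k`, traversed counterclockwise. -/
def sidePoint (g k : ℕ) (t : ℝ) : Disc :=
  ⟨(Circle.exp (2 * Real.pi * (k + t) / (4 * g)) : ℂ),
    mem_closedBall_zero_iff.2 (Circle.norm_coe _).le⟩

/-- The usual side identifications of the `4 g`-gon with boundary word
`x₁ y₁ x₁⁻¹ y₁⁻¹ ⋯ x_g y_g x_g⁻¹ y_g⁻¹`. For `g = 0` the whole boundary is collapsed to a
point. -/
inductive SideGlue (g : ℕ) : Disc → Disc → Prop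
  | x (j : ℕ) (hj : j < g) (t : ℝ) (ht : t ∈ Set.Icc (0 : ℝ) 1) :
      SideGlue g (sidePoint g (4 * j) t) (sidePoint g (4 * j + 2) (1 - t))
  | y (j : ℕ) (hj : j < g) (t : ℝ) (ht : t ∈ Set.Icc (0 : ℝ) 1) :
      SideGlue g (sidePoint g (4 * j + 1) t) (sidePoint g (4 * j + 3) (1 - t))
  | sphere (hg : g = 0) (z w : Disc) (hz : ‖(z : ℂ)‖ = 1) (hw : ‖(w : ℂ)‖ = 1) : SideGlue g z w

/-- A presentation of `S` as the closed surface of genus `g` obtained from a polygon by identifying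
its sides in the usual way. (For a compact Hausdorff space `S`, the map is then automatically a
quotient map.) -/
structure PolygonModel (S : Type*) [TopologicalSpace S] (g : ℕ) where
  toFun : Disc → S
  continuous_toFun : Continuous toFun
  surjective_toFun : Function.Surjective toFun
  eq_iff : ∀ z w, toFun z = toFun w ↔ Relation.EqvGen (SideGlue g) z w

namespace PolygonModel

variable {S : Type*} [TopologicalSpace S] {g : ℕ} (P : PolygonModel S g)

/-- The loop `x_{j+1}`, parametrized by `[0,1]`. -/
def xLoop (j : Fin g) (t : ℝ) : S := P.toFun (sidePoint g (4 * (j : ℕ)) t)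

/-- The loop `y_{j+1}`, parametrized by `[0,1]`. -/
def yLoop (j : Fin g) (t : ℝ) : S := P.toFun (sidePoint g (4 * (j : ℕ) + 1) t)

end PolygonModel

namespace OrientedLink

variable {S : Type*} [TopologicalSpace S] [ChartedSpace Plane S] {n g : ℕ} (L : OrientedLink S n)

/-- The diagram is in general position with respect to the loops `x_j`, `y_j`. -/
def GeneralPositionWith (P : PolygonModel S g) : Prop :=
  ∀ j : Fin g, L.CurveInGeneralPosition (P.xLoop j) ∧ L.CurveInGeneralPosition (P.yLoop j)

/-- The surface subgroup: the normal closure of the integrals of the diagram along the loops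
`x_j`, `y_j`. -/
def surfaceSubgroup (P : PolygonModel S g) : Subgroup L.WirtingerGroup :=
  Subgroup.normalClosure
    {w | ∃ j : Fin g, L.IsIntegral (P.xLoop j) w ∨ L.IsIntegral (P.yLoop j) w}

instance (P : PolygonModel S g) : (L.surfaceSubgroup P).Normal :=
  Subgroup.normalClosure_normal

end OrientedLink

end ThickenedSurface

end

noncomputable section

open Set Filter

namespace ThickenedSurface

/-! ### Plane geometry -/

/-! The link between the two groups is the notion of a region colouring `f : S → G` for an arc
colouring `ρ`: `f` is locally constant off the graph and is multiplied on the right by `ρ a`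
whenever the arc `a` is crossed from right to left (`IsColoringAt`, `HasJump`). Homomorphisms out of
the Wirtinger group are arc colourings satisfying `ab = ca`; homomorphisms out of the Dehn group are
functions on the regions satisfying the crossing relations and trivial on `R₀`. Around a crossing
the four quadrants carry consistent values exactly when the Wirtinger relation holds, and the Dehn
relation says exactly that the jump across the upper strand is the same before and after the
crossing.

From regions to arcs: a solution of the Dehn relations has a jump that is constant along each arc
(`IsRegionColoring.exists_arc_coloring`), and these jumps satisfy the Wirtinger relations
(`isArcColoring_of_isColoringAt`). The integral along a curve is the ratio of the end values of a
region colouring (`IsIntegral.eq_mul`), hence trivial on closed curves. Applied to the generators of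
the Dehn group, this gives a homomorphism from the Wirtinger group that kills the surface subgroup.

From arcs to regions: region colourings exist locally (`exists_isColoringAt`) and are locally unique
up to a constant left factor (`exists_mul_eq_of_isColoringAt`), so their germs form a covering of
`S` with fibre `G` (`exists_covering_of_isArcColoring`). The polygon map lifts to this covering
because the disc is contractible. If the integrals along all `x_j`, `y_j` become trivial in `G`, the
lift respects the side identifications and descends to a section, that is, to a global colouring
(`exists_global_coloring`). With `G` the quotient of the Wirtinger group, this gives a homomorphism
from the Dehn group.

The two homomorphisms are mutually inverse because a colouring of a connected surface is determined
by one value (`eq_of_isColoringAt`) and a jump is determined by the colouring (`HasJump.unique`).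

All local statements are read off in boxes (`IsBox`), oriented parametrizations in which the diagram
is one coordinate axis or both. -/

lemma cross_smul_right (v w : Plane) (r : ℝ) : cross v (r • w) = r * cross v w := by
  simp [cross]; ring

lemma cross_smul_left (v w : Plane) (r : ℝ) : cross (r • v) w = r * cross v w := by
  simp [cross]; ring

/-- This is why left and right make sense on an oriented surface: a coordinate change with positive
Jacobian preserves the sign of `cross`. -/
lemma cross_map (D : Plane →L[ℝ] Plane) (v w : Plane) :
    cross (D v) (D w) = D.det * cross v w := by
  have hdet : D.det = cross (D !₂[1, 0]) (D !₂[0, 1]) := by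
    rw [ContinuousLinearMap.det,
      ← LinearMap.det_toMatrix (EuclideanSpace.basisFun (Fin 2) ℝ).toBasis, Matrix.det_fin_two]
    have h0 : EuclideanSpace.single (0 : Fin 2) (1 : ℝ) = !₂[1, 0] := by
      ext i; fin_cases i <;> simp
    have h1 : EuclideanSpace.single (1 : Fin 2) (1 : ℝ) = !₂[0, 1] := by
      ext i; fin_cases i <;> simp
    simp only [LinearMap.toMatrix_apply, OrthonormalBasis.coe_toBasis,
      EuclideanSpace.basisFun_apply, h0, h1, OrthonormalBasis.coe_toBasis_repr_apply,
      EuclideanSpace.basisFun_repr, cross, ContinuousLinearMap.coe_coe]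
    ring
  have hdec : ∀ u : Plane, u = u 0 • !₂[(1 : ℝ), 0] + u 1 • !₂[(0 : ℝ), 1] := by
    intro u; ext i; fin_cases i <;> simp
  rw [hdet]
  conv_lhs => rw [hdec v, hdec w]
  simp only [map_add, map_smul]
  simp only [cross, PiLp.add_apply, PiLp.smul_apply, smul_eq_mul]
  ring

/-- A function that vanishes at `t` and has positive derivative there changes sign. -/
lemma eventually_sign_of_hasDerivAt {k : ℝ → ℝ} {k' t : ℝ} (hk : HasDerivAt k k' t)
    (h0 : k t = 0) (hpos : 0 < k') :
    (∀ᶠ s in 𝓝[>] t, 0 < k s) ∧ ∀ᶠ s in 𝓝[<] t, k s < 0 := by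
  have h := (hasDerivAt_iff_tendsto_slope.1 hk).eventually (lt_mem_nhds hpos)
  constructor
  · have h' := h.filter_mono (nhdsWithin_mono t (s := Ioi t) (fun s hs => ne_of_gt hs))
    filter_upwards [h', self_mem_nhdsWithin] with s hs hst
    rw [slope_def_field, h0, sub_zero] at hs
    have hst' : 0 < s - t := sub_pos.2 hst
    exact (div_pos_iff_of_pos_right hst').1 hs
  · have h' := h.filter_mono (nhdsWithin_mono t (s := Iio t) (fun s hs => ne_of_lt hs))
    filter_upwards [h', self_mem_nhdsWithin] with s hs hst
    rw [slope_def_field, h0, sub_zero] at hs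
    have hst' : s - t < 0 := sub_neg.2 hst
    by_contra hcon
    exact absurd hs (not_lt.2 (div_nonpos_of_nonneg_of_nonpos (not_lt.1 hcon) hst'.le))

lemma hasDerivAt_cross_sub {ζ : ℝ → Plane} {w : Plane} {t : ℝ} (hζ : HasDerivAt ζ w t)
    (u z : Plane) : HasDerivAt (fun s => cross u (ζ s - z)) (cross u w) t := by
  have h := fun i => (hasDerivAt_pi.1 ((PiLp.hasFDerivAt_ofLp 2 (ζ t)).comp_hasDerivAt t hζ)) i
  have h0 := h 0
  have h1 := h 1
  have h3 := ((h1.sub_const (z 1)).const_mul (u 0)).sub ((h0.sub_const (z 0)).const_mul (u 1))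
  exact h3

/-! ### Oriented parametrizations -/

variable {S : Type*} [TopologicalSpace S] [ChartedSpace Plane S]

/-- A local parametrization of the surface that is differentiable with positive Jacobian. -/
def IsOrientedParam (Ψ : OpenPartialHomeomorph Plane S) : Prop :=
  ∀ z ∈ Ψ.source, ∃ D : Plane ≃L[ℝ] Plane, 0 < (D : Plane →L[ℝ] Plane).det ∧
    HasFDerivAt (fun y => chartAt Plane (Ψ z) (Ψ y)) (D : Plane →L[ℝ] Plane) z

/-- The velocity of a curve is defined in the preferred chart at the point; the derivative of the
inverse of `Ψ` followed by that chart converts it into `Ψ`-coordinates. -/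
lemma hasDerivAt_symm_comp {Ψ : OpenPartialHomeomorph Plane S} {z : Plane} (hz : z ∈ Ψ.source)
    {D : Plane ≃L[ℝ] Plane}
    (hD : HasFDerivAt (fun y => chartAt Plane (Ψ z) (Ψ y)) (D : Plane →L[ℝ] Plane) z)
    {c : ℝ → S} {t : ℝ} (hct : c t = Ψ z) (hc : ContinuousAt c t) {w : Plane}
    (hw : HasDerivAt (fun s => chartAt Plane (c t) (c s)) (D w) t) :
    HasDerivAt (fun s => Ψ.symm (c s)) w t := by
  set e := chartAt Plane (Ψ z)
  have hze : Ψ z ∈ e.source := mem_chart_source _ _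
  have hsymm : HasFDerivAt (Ψ.trans e).symm (D.symm : Plane →L[ℝ] Plane) (e (Ψ z)) := by
    refine OpenPartialHomeomorph.hasFDerivAt_symm (Ψ.trans e) ?_ ?_
    · have : (Ψ.trans e) z ∈ (Ψ.trans e).target :=
        (Ψ.trans e).map_source (by simp [hz, hze])
      simpa using this
    · have : (Ψ.trans e).symm (e (Ψ z)) = z :=
        (Ψ.trans e).left_inv (by simp [hz, hze])
      rw [this]; exact hD
  rw [hct] at hw
  have hcomp := HasFDerivAt.comp_hasDerivAt (f := fun s => e (c s)) t
    (by rw [hct]; exact hsymm) hw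
  simp only [ContinuousLinearEquiv.coe_coe, ContinuousLinearEquiv.symm_apply_apply] at hcomp
  refine hcomp.congr_of_eventuallyEq ?_
  have : ∀ᶠ s in 𝓝 t, c s ∈ e.source :=
    hc.eventually (by rw [hct]; exact e.open_source.mem_nhds hze)
  filter_upwards [this] with s hs
  simp [e.left_inv hs]

lemma curveVelocity_comp {Ψ : OpenPartialHomeomorph Plane S} {z : Plane}
    {D : Plane ≃L[ℝ] Plane}
    (hD : HasFDerivAt (fun y => chartAt Plane (Ψ z) (Ψ y)) (D : Plane →L[ℝ] Plane) z)
    {c : ℝ → S} {t : ℝ} {ζ : ℝ → Plane} (hζt : ζ t = z) {u : Plane} (hζ : HasDerivAt ζ u t)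
    (hc : ∀ᶠ s in 𝓝 t, c s = Ψ (ζ s)) : curveVelocity c t = D u := by
  have hct : c t = Ψ z := by rw [hc.self_of_nhds, hζt]
  unfold curveVelocity
  rw [hct]
  have h := HasFDerivAt.comp_hasDerivAt t (by rw [hζt]; exact hD) hζ
  exact (h.congr_of_eventuallyEq (hc.mono fun s hs => by simp [hs])).deriv

/-- `deriv` is `0` at points of non-differentiability, so a nonzero velocity already contains
differentiability. Transversality therefore supplies all the regularity of the loops that is needed.
-/
lemma hasDerivAt_of_curveVelocity_ne_zero {c : ℝ → S} {t : ℝ} (h : curveVelocity c t ≠ 0) :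
    HasDerivAt (fun s => chartAt Plane (c t) (c s)) (curveVelocity c t) t := by
  by_contra hcon
  refine h (deriv_zero_of_not_differentiableAt fun hd => hcon hd.hasDerivAt)

/-- The straight curve through `p` with velocity `v`, in the preferred chart at `p`. -/
def line (p : S) (v : Plane) (s : ℝ) : S :=
  (chartAt Plane p).symm (chartAt Plane p p + s • v)

lemma line_zero (p : S) (v : Plane) : line p v 0 = p := by
  simp [line]

lemma continuousAt_line (p : S) (v : Plane) : ContinuousAt (line p v) 0 := by
  refine ContinuousAt.comp (g := (chartAt Plane p).symm) ?_ (by fun_prop)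
  simpa using (chartAt Plane p).continuousAt_symm (mem_chart_target Plane p)

lemma hasDerivAt_line (p : S) (v : Plane) :
    HasDerivAt (fun s => chartAt Plane (line p v 0) (line p v s)) v 0 := by
  rw [line_zero]
  have h : HasDerivAt (fun s : ℝ => chartAt Plane p p + s • v) v 0 := by
    simpa using ((hasDerivAt_id (0 : ℝ)).smul_const v).const_add (chartAt Plane p p)
  refine h.congr_of_eventuallyEq ?_
  have : ∀ᶠ s : ℝ in 𝓝 0, chartAt Plane p p + s • v ∈ (chartAt Plane p).target := by
    have hc : ContinuousAt (fun s : ℝ => chartAt Plane p p + s • v) 0 := by fun_prop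
    exact hc.eventually (by
      simpa using (chartAt Plane p).open_target.mem_nhds (mem_chart_target Plane p))
  filter_upwards [this] with s hs
  simp [line, (chartAt Plane p).right_inv hs]

lemma curveVelocity_line (p : S) (v : Plane) : curveVelocity (line p v) 0 = v :=
  (hasDerivAt_line p v).deriv

/-- Two transverse curves in a chart are the axes of an oriented local parametrization. -/
lemma exists_param_of_transverse (hS : IsOrientedAtlas S) (p : S) {g₁ g₂ : ℝ → Plane}
    (h₁ : ContDiffAt ℝ 1 g₁ 0) (h₂ : ContDiffAt ℝ 1 g₂ 0) (h₁0 : g₁ 0 = chartAt Plane p p)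
    (h₂0 : g₂ 0 = chartAt Plane p p) (hpos : 0 < cross (deriv g₁ 0) (deriv g₂ 0)) :
    ∃ (r : ℝ) (Ψ : OpenPartialHomeomorph Plane S), 0 < r ∧ IsOrientedParam Ψ ∧
      Ψ.source = Metric.ball 0 r ∧
      ∀ z ∈ Metric.ball (0 : Plane) r,
        Ψ z = (chartAt Plane p).symm (g₁ (z 0) + g₂ (z 1) - chartAt Plane p p) := by
  set e := chartAt Plane p
  -- The sum of the two curves, corrected by the base point, restricts to `g₁` and `g₂` on the axes;
  -- its derivative at `0` has these velocities as columns, so the inverse function theorem applies.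
  set Φ : Plane → Plane := fun z => g₁ (z 0) + g₂ (z 1) - e p with hΦ
  have hΦ0 : Φ 0 = e p := by simp [hΦ, h₁0, h₂0]
  have hpr : ∀ i : Fin 2, ContDiff ℝ 1 (fun z : Plane => z i) := fun i => by fun_prop
  have hΦs : ContDiffAt ℝ 1 Φ 0 := by
    refine ((ContDiffAt.comp (g := g₁) _ ?_ (hpr 0).contDiffAt).add
      (ContDiffAt.comp (g := g₂) _ ?_ (hpr 1).contDiffAt)).sub contDiffAt_const
    · simpa using h₁
    · simpa using h₂
  have hd1 : HasDerivAt g₁ (deriv g₁ 0) 0 :=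
    (h₁.differentiableAt one_ne_zero).hasDerivAt
  have hd2 : HasDerivAt g₂ (deriv g₂ 0) 0 :=
    (h₂.differentiableAt one_ne_zero).hasDerivAt
  have hΦd : HasFDerivAt Φ (fderiv ℝ Φ 0) 0 := (hΦs.differentiableAt one_ne_zero).hasFDerivAt
  have hdir1 : fderiv ℝ Φ 0 !₂[1, 0] = deriv g₁ 0 := by
    have hl : HasDerivAt (fun s : ℝ => s • (!₂[1, 0] : Plane)) !₂[1, 0] 0 := by
      simpa using (hasDerivAt_id (0 : ℝ)).smul_const (!₂[1, 0] : Plane)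
    have h := HasFDerivAt.comp_hasDerivAt (0 : ℝ) (l := Φ) (by simpa using hΦd) hl
    refine h.unique ?_
    refine hd1.congr_of_eventuallyEq (Eventually.of_forall fun s => ?_)
    simp [hΦ, h₂0]
  have hdir2 : fderiv ℝ Φ 0 !₂[0, 1] = deriv g₂ 0 := by
    have hl : HasDerivAt (fun s : ℝ => s • (!₂[0, 1] : Plane)) !₂[0, 1] 0 := by
      simpa using (hasDerivAt_id (0 : ℝ)).smul_const (!₂[0, 1] : Plane)
    have h := HasFDerivAt.comp_hasDerivAt (0 : ℝ) (l := Φ) (by simpa using hΦd) hl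
    refine h.unique ?_
    refine hd2.congr_of_eventuallyEq (Eventually.of_forall fun s => ?_)
    simp [hΦ, h₁0]
  have hdet0 : 0 < (fderiv ℝ Φ 0).det := by
    have := cross_map (fderiv ℝ Φ 0) !₂[1, 0] !₂[0, 1]
    rw [hdir1, hdir2] at this
    rw [this] at hpos
    simpa [cross] using hpos
  have hdetcont : ContinuousAt (fun z => (fderiv ℝ Φ z).det) 0 :=
    ContinuousLinearMap.continuous_det.continuousAt.comp (hΦs.continuousAt_fderiv one_ne_zero)
  set D0 := (fderiv ℝ Φ 0).toContinuousLinearEquivOfDetNeZero hdet0.ne' with hD0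
  have hΦd' : HasFDerivAt Φ (D0 : Plane →L[ℝ] Plane) 0 := hΦd
  set Φ' := hΦs.toOpenPartialHomeomorph Φ hΦd' one_ne_zero with hΦ'
  have hΦ'c : (Φ' : Plane → Plane) = Φ := rfl
  have h0src : (0 : Plane) ∈ Φ'.source := hΦs.mem_toOpenPartialHomeomorph_source hΦd' one_ne_zero
  have hev : ∀ᶠ z in 𝓝 (0 : Plane), z ∈ Φ'.source ∧ Φ z ∈ e.target ∧ 0 < (fderiv ℝ Φ z).det ∧
      DifferentiableAt ℝ Φ z := by
    have ha : ∀ᶠ z in 𝓝 (0 : Plane), z ∈ Φ'.source := Φ'.open_source.mem_nhds h0src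
    have hb : ∀ᶠ z in 𝓝 (0 : Plane), Φ z ∈ e.target := hΦs.continuousAt.eventually
      (by rw [hΦ0]; exact e.open_target.mem_nhds (mem_chart_target Plane p))
    refine ha.and (hb.and ((hdetcont.eventually (lt_mem_nhds hdet0)).and ?_))
    exact (hΦs.eventually (by simp)).mono fun z hz => hz.differentiableAt one_ne_zero
  obtain ⟨r, hr, hball⟩ := Metric.eventually_nhds_iff_ball.1 hev
  refine ⟨r, (Φ'.trans e.symm).restrOpen (Metric.ball 0 r) Metric.isOpen_ball, hr, ?_, ?_, ?_⟩
  · intro z hz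
    have hzb : z ∈ Metric.ball (0 : Plane) r := by
      rw [OpenPartialHomeomorph.restrOpen_source] at hz; exact hz.2
    obtain ⟨hzs, hzt, hzdet, hzd⟩ := hball z hzb
    set q := e.symm (Φ z)
    set e' := chartAt Plane q
    have hq : q ∈ e'.source := mem_chart_source _ _
    have htr : Φ z ∈ (e.symm ≫ₕ e').source := by
      simp only [OpenPartialHomeomorph.trans_source, OpenPartialHomeomorph.symm_source,
        mem_inter_iff, mem_preimage]
      exact ⟨hzt, hq⟩
    have hdet' := hS e (chart_mem_atlas _ _) e' (chart_mem_atlas _ _) _ htr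
    -- The positive Jacobian itself forces differentiability: otherwise `fderiv` would be `0`, with
    -- determinant `0` in dimension two.
    have hdiff : DifferentiableAt ℝ (e.symm ≫ₕ e') (Φ z) := by
      by_contra hcon
      rw [fderiv_zero_of_not_differentiableAt hcon] at hdet'
      simp [ContinuousLinearMap.det] at hdet'
    have hcomp := hdiff.hasFDerivAt.comp z hzd.hasFDerivAt
    set D := (fderiv ℝ (e.symm ≫ₕ e') (Φ z)).comp (fderiv ℝ Φ z) with hD
    have hDdet : 0 < D.det := by
      have : D.det = (fderiv ℝ (e.symm ≫ₕ e') (Φ z)).det * (fderiv ℝ Φ z).det := by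
        simp only [hD, ContinuousLinearMap.det, ContinuousLinearMap.toLinearMap_comp]
        exact LinearMap.det_comp _ _
      rw [this]; exact mul_pos hdet' hzdet
    refine ⟨D.toContinuousLinearEquivOfDetNeZero hDdet.ne', ?_, ?_⟩
    · exact hDdet
    · exact hcomp
  · rw [OpenPartialHomeomorph.restrOpen_source]
    refine inter_eq_right.2 fun z hz => ?_
    obtain ⟨hzs, hzt, -, -⟩ := hball z hz
    simp only [OpenPartialHomeomorph.trans_source, OpenPartialHomeomorph.symm_source,
        mem_inter_iff, mem_preimage]
    exact ⟨hzs, hzt⟩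
  · intro z hz
    rfl

end ThickenedSurface

/-! ### Local normal form of the diagram: jumps and boxes. -/

namespace ThickenedSurface

namespace OrientedLink

variable {S : Type*} [TopologicalSpace S] {n : ℕ} (L : OrientedLink S n)

lemma shift_zero (θ : Fin n × UnitAddCircle) : shift θ 0 = θ := by
  simp [shift]

lemma shift_shift (θ : Fin n × UnitAddCircle) (s t : ℝ) :
    shift (shift θ s) t = shift θ (s + t) := by
  simp [shift, add_assoc]

lemma continuous_shift (θ : Fin n × UnitAddCircle) : Continuous (shift θ) := by
  have : Continuous (fun s : ℝ => (s : UnitAddCircle)) := AddCircle.continuous_mk' 1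
  unfold shift
  fun_prop

lemma continuous_proj : Continuous L.proj := continuous_fst.comp L.continuous_toFun

/-- The quotient map `ℝ → ℝ/ℤ` is open and the set of components is discrete, so short travel times
sweep out a neighbourhood. -/
lemma image_shift_mem_nhds (θ : Fin n × UnitAddCircle) {δ : ℝ} (hδ : 0 < δ) :
    shift θ '' Metric.ball 0 δ ∈ 𝓝 θ := by
  have h1 : IsOpen ((fun s : ℝ => (s : UnitAddCircle)) '' Metric.ball 0 δ) :=
    QuotientAddGroup.isOpenMap_coe _ Metric.isOpen_ball
  have h2 : IsOpen ((fun x => θ.2 + x) '' ((fun s : ℝ => (s : UnitAddCircle)) '' Metric.ball 0 δ)) :=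
    isOpenMap_add_left θ.2 _ h1
  have h3 : IsOpen (({θ.1} : Set (Fin n)) ×ˢ
      ((fun x => θ.2 + x) '' ((fun s : ℝ => (s : UnitAddCircle)) '' Metric.ball 0 δ))) :=
    (isOpen_discrete _).prod h2
  refine mem_of_superset (h3.mem_nhds ⟨rfl, 0, ⟨0, by simpa using hδ, by simp⟩, by simp⟩) ?_
  rintro ⟨i, x⟩ ⟨hi, -, ⟨s, hs, rfl⟩, hx⟩
  exact ⟨s, hs, Prod.ext hi.symm hx⟩

lemma isClosed_underlyingGraph [T2Space S] : IsClosed L.underlyingGraph :=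
  (isCompact_range L.continuous_proj).isClosed

variable [ChartedSpace Plane S]

lemma velocity_eq_deriv (θ : Fin n × UnitAddCircle) :
    L.velocity θ = deriv (fun s : ℝ => chartAt Plane (L.proj θ) (L.proj (shift θ s))) 0 := by
  simp [velocity, curveVelocity, shift_zero]

lemma InGeneralPosition.contDiffAt [IsManifold (𝓡 2) ∞ S] {L : OrientedLink S n}
    (hL : L.InGeneralPosition) (θ : Fin n × UnitAddCircle) :
    ContDiffAt ℝ 1 (fun s : ℝ => chartAt Plane (L.proj θ) (L.proj (shift θ s))) 0 := by
  obtain ⟨i, x⟩ := θ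
  induction x using QuotientAddGroup.induction_on with | _ x => ?_
  have h1 : ContMDiff 𝓘(ℝ, ℝ) (𝓡 2) ∞ (fun s : ℝ => L.proj (shift (i, (x : UnitAddCircle)) s)) := by
    have hadd : ContMDiff 𝓘(ℝ, ℝ) 𝓘(ℝ, ℝ) ∞ (fun s : ℝ => x + s) :=
      (contDiff_const.add contDiff_id).contMDiff
    exact (hL.smooth i).comp hadd
  have h2 : ContMDiffAt 𝓘(ℝ, ℝ) 𝓘(ℝ, Plane) ∞
      (fun s : ℝ => extChartAt (𝓡 2) (L.proj (i, (x : UnitAddCircle)))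
        (L.proj (shift (i, (x : UnitAddCircle)) s))) 0 := by
    refine ContMDiffAt.comp (I' := 𝓡 2) (0 : ℝ) ?_ h1.contMDiffAt
    rw [shift_zero]
    exact contMDiffAt_extChartAt
  have h3 := h2.contDiffAt.of_le (m := 1) (by exact_mod_cast le_top)
  simpa [extChartAt] using h3

/-- Crossing the strand at `θ` from right to left multiplies the value of `f` by `x`. -/
def HasJump {G : Type*} [Group G] (f : S → G) (θ : Fin n × UnitAddCircle) (x : G) : Prop :=
  ∀ (c : ℝ → S) (t : ℝ), c t = L.proj θ → ContinuousAt c t →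
    0 < cross (L.velocity θ) (curveVelocity c t) →
    ∃ h, (∀ᶠ s in 𝓝[<] t, f (c s) = h) ∧ ∀ᶠ s in 𝓝[>] t, f (c s) = h * x

variable {L}

/-- A curve with coordinate velocity `w` on the left of `u` passes from the right to the left. -/
lemma eventually_side {Ψ : OpenPartialHomeomorph Plane S} {z : Plane} (hz : z ∈ Ψ.source)
    {D : Plane ≃L[ℝ] Plane}
    (hD : HasFDerivAt (fun y => chartAt Plane (Ψ z) (Ψ y)) (D : Plane →L[ℝ] Plane) z)
    {c : ℝ → S} {t : ℝ} (hct : c t = Ψ z) (hc : ContinuousAt c t) {w : Plane}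
    (hw : HasDerivAt (fun s => chartAt Plane (c t) (c s)) (D w) t) {u : Plane}
    (huw : 0 < cross u w) {P Q : S → Prop}
    (hP : ∀ᶠ y in 𝓝 z, 0 < cross u (y - z) → P (Ψ y))
    (hQ : ∀ᶠ y in 𝓝 z, cross u (y - z) < 0 → Q (Ψ y)) :
    (∀ᶠ s in 𝓝[>] t, P (c s)) ∧ ∀ᶠ s in 𝓝[<] t, Q (c s) := by
  have h := hasDerivAt_symm_comp hz hD hct hc hw
  have hzt : Ψ.symm (c t) = z := by rw [hct, Ψ.left_inv hz]
  obtain ⟨h1, h2⟩ := eventually_sign_of_hasDerivAt (hasDerivAt_cross_sub h u z)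
    (by rw [hzt]; simp [cross]) huw
  have hlim : Tendsto (fun s => Ψ.symm (c s)) (𝓝 t) (𝓝 z) := by
    have := h.continuousAt.tendsto
    rwa [hzt] at this
  have htgt : ∀ᶠ s in 𝓝 t, c s ∈ Ψ.target :=
    hc.eventually (Ψ.open_target.mem_nhds (by rw [hct]; exact Ψ.map_source hz))
  constructor
  · filter_upwards [h1, (hlim.eventually hP).filter_mono nhdsWithin_le_nhds,
      htgt.filter_mono nhdsWithin_le_nhds] with s hs1 hs2 hs3
    simpa [Ψ.right_inv hs3] using hs2 hs1
  · filter_upwards [h2, (hlim.eventually hQ).filter_mono nhdsWithin_le_nhds,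
      htgt.filter_mono nhdsWithin_le_nhds] with s hs1 hs2 hs3
    simpa [Ψ.right_inv hs3] using hs2 hs1

/-- Turns the condition on all transverse curves into one equation between the values on the two
sides of a straightened strand. Forwards, it is tested on a straight line crossing perpendicularly
in coordinates; backwards, every transverse curve is on the right just before and on the left just
after. -/
lemma hasJump_iff {G : Type*} [Group G] {f : S → G} {θ : Fin n × UnitAddCircle} {x : G}
    {Ψ : OpenPartialHomeomorph Plane S} (hΨ : IsOrientedParam Ψ) {z : Plane} (hz : z ∈ Ψ.source)
    {u : Plane} (hu0 : u ≠ 0) (hu : ∀ᶠ s : ℝ in 𝓝 0, L.proj (shift θ s) = Ψ (z + s • u))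
    {hp hm : G} (hleft : ∀ᶠ y in 𝓝 z, 0 < cross u (y - z) → f (Ψ y) = hp)
    (hright : ∀ᶠ y in 𝓝 z, cross u (y - z) < 0 → f (Ψ y) = hm) :
    L.HasJump f θ x ↔ hp = hm * x := by
  obtain ⟨D, hDpos, hD⟩ := hΨ z hz
  have hζ : HasDerivAt (fun s : ℝ => z + s • u) u 0 := by
    simpa using ((hasDerivAt_id (0 : ℝ)).smul_const u).const_add z
  have hvel : L.velocity θ = D u := curveVelocity_comp hD (by simp) hζ hu
  have hpz : L.proj θ = Ψ z := by
    have := hu.self_of_nhds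
    simpa [shift_zero] using this
  constructor
  · intro hJ
    set w : Plane := !₂[-u 1, u 0]
    have huw : 0 < cross u w := by
      have : u 0 ≠ 0 ∨ u 1 ≠ 0 := by
        by_contra! hcon
        exact hu0 (by ext i; fin_cases i <;> simp [hcon])
      simp only [cross, w, Matrix.cons_val_zero, Matrix.cons_val_one]
      rcases this with h | h <;> nlinarith [sq_nonneg (u 0), sq_nonneg (u 1), sq_pos_of_ne_zero h]
    obtain ⟨h, h1, h2⟩ := hJ (line (L.proj θ) (D w)) 0 (line_zero _ _) (continuousAt_line _ _) (by
      rw [curveVelocity_line, hvel, ← ContinuousLinearEquiv.coe_coe, cross_map]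
      exact mul_pos hDpos huw)
    obtain ⟨h3, h4⟩ := eventually_side (P := fun q => f q = hp) (Q := fun q => f q = hm) hz hD
      ((line_zero _ _).trans hpz) (continuousAt_line _ _) (hasDerivAt_line (L.proj θ) (D w))
      huw hleft hright
    obtain ⟨s, hs1, hs2⟩ := (h1.and h4).exists
    obtain ⟨s', hs3, hs4⟩ := (h2.and h3).exists
    rw [← hs4, hs3, ← hs1, hs2]
  · intro hx c t hct hc hpos
    have hV0 : curveVelocity c t ≠ 0 := by
      intro h0; rw [h0] at hpos; simp [cross] at hpos
    have hV := hasDerivAt_of_curveVelocity_ne_zero hV0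
    obtain ⟨w, hw⟩ := D.surjective (curveVelocity c t)
    rw [hvel, ← hw, ← ContinuousLinearEquiv.coe_coe, cross_map] at hpos
    rw [← hw] at hV
    obtain ⟨h3, h4⟩ := eventually_side (P := fun q => f q = hp) (Q := fun q => f q = hm) hz hD
      (hct.trans hpz) hc hV ((pos_iff_pos_of_mul_pos hpos).1 hDpos) hleft hright
    exact ⟨hm, h4, by rw [← hx]; exact h3⟩

/-- Crossing from left to right is crossing from right to left with time reversed. -/
lemma HasJump.of_neg {G : Type*} [Group G] {f : S → G} {θ : Fin n × UnitAddCircle} {x : G}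
    (hJ : L.HasJump f θ x) {c : ℝ → S} {t : ℝ} (hct : c t = L.proj θ) (hc : ContinuousAt c t)
    (hneg : cross (L.velocity θ) (curveVelocity c t) < 0) :
    ∃ h, (∀ᶠ s in 𝓝[<] t, f (c s) = h) ∧ ∀ᶠ s in 𝓝[>] t, f (c s) = h * x⁻¹ := by
  have hV0 : curveVelocity c t ≠ 0 := by
    intro h0; rw [h0] at hneg; simp [cross] at hneg
  have hV := hasDerivAt_of_curveVelocity_ne_zero hV0
  have hvel : curveVelocity (fun s => c (-s)) (-t) = -curveVelocity c t := by
    have h := deriv_comp_neg (fun s => chartAt Plane (c t) (c s)) (-t)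
    simpa [curveVelocity] using h
  obtain ⟨h, h1, h2⟩ := hJ (fun s => c (-s)) (-t) (by simpa using hct)
    (by
      refine ContinuousAt.comp (g := c) ?_ continuous_neg.continuousAt
      simpa using hc)
    (by
      rw [hvel]
      have : cross (L.velocity θ) (-curveVelocity c t)
          = -cross (L.velocity θ) (curveVelocity c t) := by simp [cross]; ring
      rw [this]; linarith)
  refine ⟨h * x, ?_, ?_⟩
  · have : Tendsto (fun s : ℝ => -s) (𝓝[<] t) (𝓝[>] (-t)) := tendsto_neg_nhdsLT
    simpa using this.eventually h2
  · have : Tendsto (fun s : ℝ => -s) (𝓝[>] t) (𝓝[<] (-t)) := tendsto_neg_nhdsGT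
    simpa using this.eventually h1

variable (L)

/-- An oriented local parametrization by a disc that meets the projected link precisely in the
strand at `θ`, as the first axis, and, along the second axis, in the points of the family `T`. -/
structure IsBox (θ : Fin n × UnitAddCircle) (T : ℝ → Set (Fin n × UnitAddCircle)) (r : ℝ)
    (Ψ : OpenPartialHomeomorph Plane S) : Prop where
  pos : 0 < r
  oriented : IsOrientedParam Ψ
  source_eq : Ψ.source = Metric.ball 0 r
  proj_eq_iff : ∀ z ∈ Metric.ball (0 : Plane) r, ∀ θ', L.proj θ' = Ψ z ↔
    (z 1 = 0 ∧ θ' = shift θ (z 0)) ∨ (z 0 = 0 ∧ θ' ∈ T (z 1))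

lemma norm_axis_left (s : ℝ) : ‖(!₂[s, 0] : Plane)‖ = |s| := by
  simp [EuclideanSpace.norm_eq, Real.sqrt_sq_eq_abs]

lemma norm_axis_right (s : ℝ) : ‖(!₂[0, s] : Plane)‖ = |s| := by
  simp [EuclideanSpace.norm_eq, Real.sqrt_sq_eq_abs]

variable {L}

/-- A compactness argument: `W` is a neighbourhood of all parameters over the centre, so the rest of
the link has a compact image that misses the centre. After shrinking the disc, only the points on
the two prescribed axes remain. -/
lemma exists_isBox_of_param [T2Space S] {θ : Fin n × UnitAddCircle}
    {T : ℝ → Set (Fin n × UnitAddCircle)} {r₀ : ℝ} {Ψ₀ : OpenPartialHomeomorph Plane S}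
    (hr₀ : 0 < r₀) (hΨ₀ : IsOrientedParam Ψ₀) (hsrc : Ψ₀.source = Metric.ball 0 r₀)
    (h1 : ∀ s, |s| < r₀ → L.proj (shift θ s) = Ψ₀ !₂[s, 0])
    (h2 : ∀ t, |t| < r₀ → ∀ θ' ∈ T t, L.proj θ' = Ψ₀ !₂[0, t])
    (h3 : ∀ θ', L.proj θ' = L.proj θ → θ' = θ ∨ θ' ∈ T 0)
    (h4 : ∀ θ' ∈ T 0, {θ'' | ∃ t, |t| < r₀ ∧ θ'' ∈ T t} ∈ 𝓝 θ')
    {U : Set S} (hU : U ∈ 𝓝 (L.proj θ)) :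
    ∃ r Ψ, L.IsBox θ T r Ψ ∧ Ψ.target ⊆ U ∧ ∀ z, Ψ z = Ψ₀ z := by
  have h0 : L.proj θ = Ψ₀ 0 := by
    have h := h1 0 (by simpa using hr₀)
    rw [shift_zero] at h
    rw [h]; congr 1; ext i; fin_cases i <;> simp
  have h0s : (0 : Plane) ∈ Ψ₀.source := by rw [hsrc]; simpa using hr₀
  set W : Set (Fin n × UnitAddCircle) := {θ' | (∃ s, |s| < r₀ ∧ θ' = shift θ s) ∨
    ∃ t, |t| < r₀ ∧ θ' ∈ T t} with hW
  have hWn : ∀ θ', L.proj θ' = L.proj θ → θ' ∈ interior W := by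
    intro θ' hθ'
    rw [mem_interior_iff_mem_nhds]
    rcases h3 θ' hθ' with rfl | hT
    · refine mem_of_superset (image_shift_mem_nhds θ' hr₀) ?_
      rintro _ ⟨s, hs, rfl⟩
      exact Or.inl ⟨s, by simpa using hs, rfl⟩
    · exact mem_of_superset (h4 θ' hT) fun θ'' h => Or.inr h
  have hK : IsClosed (L.proj '' (interior W)ᶜ) :=
    (isOpen_interior.isClosed_compl.isCompact.image L.continuous_proj).isClosed
  have hKn : (L.proj '' (interior W)ᶜ)ᶜ ∈ 𝓝 (L.proj θ) := by
    refine hK.isOpen_compl.mem_nhds ?_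
    rintro ⟨θ', hθ', he⟩
    exact hθ' (hWn θ' he)
  have hev : ∀ᶠ z in 𝓝 (0 : Plane), Ψ₀ z ∈ (L.proj '' (interior W)ᶜ)ᶜ ∩ U ∧ z ∈ Ψ₀.source := by
    refine Eventually.and ?_ (Ψ₀.open_source.mem_nhds h0s)
    refine (Ψ₀.continuousAt h0s).eventually (inter_mem ?_ ?_)
    · rw [← h0]; exact hKn
    · rw [← h0]; exact hU
  obtain ⟨r, hr, hball⟩ := Metric.eventually_nhds_iff_ball.1 hev
  have hsrc' : (Ψ₀.restrOpen (Metric.ball 0 r) Metric.isOpen_ball).source = Metric.ball 0 r := by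
    rw [OpenPartialHomeomorph.restrOpen_source]
    exact inter_eq_right.2 fun z hz => (hball z hz).2
  refine ⟨r, Ψ₀.restrOpen (Metric.ball 0 r) Metric.isOpen_ball, ⟨hr, ?_, hsrc', ?_⟩, ?_,
    fun z => rfl⟩
  · intro z hz
    exact hΨ₀ z (by rw [OpenPartialHomeomorph.restrOpen_source] at hz; exact hz.1)
  · intro z hz θ'
    change L.proj θ' = Ψ₀ z ↔ _
    have hzs := (hball z hz).2
    have hzr : ‖z‖ < r₀ := by rw [hsrc] at hzs; simpa using hzs
    constructor
    · intro he
      have hθW : θ' ∈ W := by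
        by_contra hcon
        exact (hball z hz).1.1 ⟨θ', fun h => hcon (interior_subset h), he⟩
      rcases hθW with ⟨s, hs, rfl⟩ | ⟨t, ht, hT⟩
      · left
        have : !₂[s, 0] = z := Ψ₀.injOn (by rw [hsrc]; simpa [norm_axis_left] using hs) hzs
          ((h1 s hs).symm.trans he)
        rw [← this]; simp
      · right
        have : !₂[0, t] = z := Ψ₀.injOn (by rw [hsrc]; simpa [norm_axis_right] using ht) hzs
          ((h2 t ht _ hT).symm.trans he)
        rw [← this]; simpa using hT
    · have hz0 : ∀ i, |z i| < r₀ := fun i => lt_of_le_of_lt (PiLp.norm_apply_le z i) hzr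
      rintro (⟨hz1, rfl⟩ | ⟨hz1, hT⟩)
      · rw [h1 _ (hz0 0)]
        congr 1; ext i; fin_cases i <;> simp [hz1]
      · rw [h2 _ (hz0 1) _ hT]
        congr 1; ext i; fin_cases i <;> simp [hz1]
  · intro q hq
    have hq' := OpenPartialHomeomorph.map_target _ hq
    rw [hsrc'] at hq'
    have := (hball _ hq').1.2
    have hri := OpenPartialHomeomorph.right_inv _ hq
    rw [← hri]
    exact this

lemma crossingSign_eq_or (hL : L.InGeneralPosition) {o u : Fin n × UnitAddCircle} (hne : o ≠ u)
    (hp : L.proj o = L.proj u) : L.crossingSign o u = 1 ∨ L.crossingSign o u = -1 := by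
  have := hL.transverse o u hne hp
  unfold crossingSign
  rcases lt_or_gt_of_ne this with h | h
  · right; simp [sign_neg h]
  · left; simp [sign_pos h]

lemma crossingSign_mul_cross_pos (hL : L.InGeneralPosition) {o u : Fin n × UnitAddCircle}
    (hne : o ≠ u) (hp : L.proj o = L.proj u) :
    0 < L.crossingSign o u * cross (L.velocity o) (L.velocity u) := by
  have := hL.transverse o u hne hp
  unfold crossingSign
  rcases lt_or_gt_of_ne this with h | h
  · simpa [sign_neg h] using h
  · simpa [sign_pos h] using h

variable [T2Space S] [IsManifold (𝓡 2) ∞ S]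

lemma exists_simpleBox (hS : IsOrientedAtlas S) (hL : L.InGeneralPosition)
    {θ : Fin n × UnitAddCircle} (hθ : L.IsSimplePoint θ) {U : Set S} (hU : U ∈ 𝓝 (L.proj θ)) :
    ∃ r Ψ, L.IsBox θ (fun _ => ∅) r Ψ ∧ Ψ.target ⊆ U := by
  set e := chartAt Plane (L.proj θ)
  set v := L.velocity θ with hv
  -- The second axis may be any curve crossing the strand from right to left; here it is the
  -- straight line along the velocity turned by a right angle.
  set w : Plane := !₂[-v 1, v 0]
  have hvw : 0 < cross v w := by
    have : v 0 ≠ 0 ∨ v 1 ≠ 0 := by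
      by_contra! hcon
      exact hL.immersion θ (by ext i; fin_cases i <;> simp [← hv, hcon])
    simp only [cross, w, Matrix.cons_val_zero, Matrix.cons_val_one]
    rcases this with h | h <;> nlinarith [sq_nonneg (v 0), sq_nonneg (v 1), sq_pos_of_ne_zero h]
  have hd2 : HasDerivAt (fun s : ℝ => e (L.proj θ) + s • w) w 0 := by
    simpa using ((hasDerivAt_id (0 : ℝ)).smul_const w).const_add (e (L.proj θ))
  obtain ⟨r₀, Ψ₀, hr₀, hor, hsrc, hΨ₀⟩ := exists_param_of_transverse hS (L.proj θ)
    (g₂ := fun s : ℝ => e (L.proj θ) + s • w) (hL.contDiffAt θ) (by fun_prop)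
    (by simp [shift_zero]) (by simp [e]) (by
      rw [← velocity_eq_deriv, hd2.deriv]; exact hvw)
  have hcont : ∀ᶠ s : ℝ in 𝓝 0, L.proj (shift θ s) ∈ e.source := by
    have := (L.continuous_proj.comp (continuous_shift θ)).continuousAt (x := (0 : ℝ))
    refine this.eventually (e.open_source.mem_nhds ?_)
    simp [shift_zero, e]
  obtain ⟨r₁, hr₁, hb₁⟩ := Metric.eventually_nhds_iff_ball.1 hcont
  obtain ⟨r, Ψ, hb, hs, -⟩ := exists_isBox_of_param (L := L) (θ := θ) (T := fun _ => ∅)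
    (r₀ := min r₀ r₁) (Ψ₀ := Ψ₀.restrOpen (Metric.ball 0 (min r₀ r₁)) Metric.isOpen_ball)
    (lt_min hr₀ hr₁)
    (by
      intro z hz
      exact hor z (by rw [OpenPartialHomeomorph.restrOpen_source] at hz; exact hz.1))
    (by
      rw [OpenPartialHomeomorph.restrOpen_source, hsrc]
      exact inter_eq_right.2 (Metric.ball_subset_ball (min_le_left _ _)))
    (by
      intro s hs
      change _ = Ψ₀ _
      rw [hΨ₀ _ (by simpa [norm_axis_left] using hs.trans_le (min_le_left _ _))]
      simp only [Matrix.cons_val_zero, Matrix.cons_val_one, zero_smul, add_zero]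
      rw [add_sub_cancel_right, e.left_inv (hb₁ s (by simpa using hs.trans_le (min_le_right _ _)))])
    (by simp) (fun θ' h => Or.inl (hθ θ' h)) (by simp) hU
  exact ⟨r, Ψ, hb, hs⟩

/-- The second axis is the lower strand, traversed with direction `σ` so that it always runs from
the right to the left of the upper one. The box is thus oriented for both crossing signs, and
absence of triple points leaves no other strand. -/
lemma exists_crossingBox (hS : IsOrientedAtlas S) (hL : L.InGeneralPosition)
    {o u : Fin n × UnitAddCircle} (hne : o ≠ u) (hp : L.proj o = L.proj u)
    {U : Set S} (hU : U ∈ 𝓝 (L.proj o)) :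
    ∃ r Ψ, L.IsBox o (fun t => {shift u (L.crossingSign o u * t)}) r Ψ ∧ Ψ.target ⊆ U := by
  set e := chartAt Plane (L.proj o)
  set σ := L.crossingSign o u with hσ
  have hσabs : |σ| = 1 := by
    rcases crossingSign_eq_or hL hne hp with h | h <;> simp [hσ, h]
  have hσσ : σ * σ = 1 := by
    rcases crossingSign_eq_or hL hne hp with h | h <;> simp [hσ, h]
  have hgu : ContDiffAt ℝ 1 (fun s : ℝ => e (L.proj (shift u s))) 0 := by
    have := hL.contDiffAt u
    rwa [← hp] at this
  have hd : HasDerivAt (fun s : ℝ => e (L.proj (shift u s))) (L.velocity u) 0 := by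
    rw [velocity_eq_deriv, ← hp]
    exact (hgu.differentiableAt one_ne_zero).hasDerivAt
  have hmul : HasDerivAt (fun s : ℝ => σ * s) σ 0 := by
    simpa using (hasDerivAt_id (0 : ℝ)).const_mul σ
  have hd2 : HasDerivAt (fun s : ℝ => e (L.proj (shift u (σ * s)))) (σ • L.velocity u) 0 := by
    refine HasDerivAt.scomp (g₁ := fun s : ℝ => e (L.proj (shift u s))) (0 : ℝ) ?_ hmul
    simpa using hd
  obtain ⟨r₀, Ψ₀, hr₀, hor, hsrc, hΨ₀⟩ := exists_param_of_transverse hS (L.proj o)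
    (g₂ := fun s : ℝ => e (L.proj (shift u (σ * s)))) (hL.contDiffAt o)
    (by
      refine ContDiffAt.comp (g := fun s : ℝ => e (L.proj (shift u s))) (0 : ℝ) ?_ (by fun_prop)
      simpa using hgu)
    (by simp [shift_zero]) (by simp [shift_zero, e, hp]) (by
      rw [← velocity_eq_deriv, hd2.deriv, cross_smul_right]
      exact crossingSign_mul_cross_pos hL hne hp)
  have hcont : ∀ θ, L.proj θ = L.proj o → ∀ᶠ s : ℝ in 𝓝 0, L.proj (shift θ s) ∈ e.source := by
    intro θ hθ
    have := (L.continuous_proj.comp (continuous_shift θ)).continuousAt (x := (0 : ℝ))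
    refine this.eventually (e.open_source.mem_nhds ?_)
    simp [shift_zero, hθ, e]
  obtain ⟨r₁, hr₁, hb₁⟩ := Metric.eventually_nhds_iff_ball.1 ((hcont o rfl).and (hcont u hp.symm))
  obtain ⟨r, Ψ, hb, hs, -⟩ := exists_isBox_of_param (L := L) (θ := o)
    (T := fun t => {shift u (σ * t)})
    (r₀ := min r₀ r₁) (Ψ₀ := Ψ₀.restrOpen (Metric.ball 0 (min r₀ r₁)) Metric.isOpen_ball)
    (lt_min hr₀ hr₁)
    (by
      intro z hz
      exact hor z (by rw [OpenPartialHomeomorph.restrOpen_source] at hz; exact hz.1))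
    (by
      rw [OpenPartialHomeomorph.restrOpen_source, hsrc]
      exact inter_eq_right.2 (Metric.ball_subset_ball (min_le_left _ _)))
    (by
      intro s hs
      change _ = Ψ₀ _
      rw [hΨ₀ _ (by simpa [norm_axis_left] using hs.trans_le (min_le_left _ _))]
      simp only [Matrix.cons_val_zero, Matrix.cons_val_one, mul_zero, shift_zero,
        ← hp]
      rw [add_sub_cancel_right,
        e.left_inv (hb₁ s (by simpa using hs.trans_le (min_le_right _ _))).1])
    (by
      rintro s hs _ rfl
      change _ = Ψ₀ _
      rw [hΨ₀ _ (by simpa [norm_axis_right] using hs.trans_le (min_le_left _ _))]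
      simp only [Matrix.cons_val_zero, Matrix.cons_val_one, shift_zero]
      rw [add_sub_cancel_left, e.left_inv (hb₁ (σ * s)
        (by simpa [abs_mul, hσabs] using hs.trans_le (min_le_right _ _))).2])
    (by
      intro θ' hθ'
      simp only [mul_zero, shift_zero, mem_singleton_iff]
      rcases hL.no_triple θ' o u hθ' hp with h | h | h
      · exact Or.inl h
      · exact absurd h hne
      · exact Or.inr h)
    (by
      rintro θ' hθ'
      simp only [mul_zero, shift_zero, mem_singleton_iff] at hθ'
      subst hθ'
      refine mem_of_superset (image_shift_mem_nhds θ' (lt_min hr₀ hr₁)) ?_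
      rintro _ ⟨s, hs, rfl⟩
      refine ⟨σ * s, by simpa [abs_mul, hσabs] using hs, ?_⟩
      rw [← mul_assoc, hσσ, one_mul]; rfl) hU
  exact ⟨r, Ψ, hb, hs⟩

end OrientedLink

end ThickenedSurface

namespace ThickenedSurface

namespace OrientedLink

variable {S : Type*} [TopologicalSpace S] {n : ℕ} {L : OrientedLink S n}

/-! ### Arcs -/

lemma IsSimplePoint.not_isUnder {θ : Fin n × UnitAddCircle} (h : L.IsSimplePoint θ) :
    ¬ L.IsUnder θ := by
  rintro ⟨o, ho, hlt⟩
  rw [h o ho] at hlt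
  exact lt_irrefl _ hlt

lemma IsCrossing.ne {o u : Fin n × UnitAddCircle} (h : L.IsCrossing o u) : o ≠ u := by
  rintro rfl
  exact lt_irrefl _ h.2

lemma exists_isCrossing_of_not_isSimplePoint {θ : Fin n × UnitAddCircle}
    (h : ¬ L.IsSimplePoint θ) (hu : ¬ L.IsUnder θ) : ∃ u, L.IsCrossing θ u := by
  unfold IsSimplePoint at h
  push Not at h
  obtain ⟨θ', hp, hne⟩ := h
  rcases lt_trichotomy (L.height θ) (L.height θ') with hlt | heq | hlt
  · exact absurd ⟨θ', hp, hlt⟩ hu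
  -- Equal heights over the same point would contradict the injectivity of the link.
  · exact absurd (L.injective_toFun (Prod.ext hp heq.symm)) hne
  · exact ⟨θ', hp.symm, hlt⟩

/-- Arcs are components of the set of parameters that are not undercrossings, and a connected set of
travel times within it has connected image. -/
lemma onArc_of_isPreconnected {θ : Fin n × UnitAddCircle} {I : Set ℝ} (hI : IsPreconnected I)
    (hu : ∀ s ∈ I, ¬ L.IsUnder (shift θ s)) {s t : ℝ} (hs : s ∈ I) (ht : t ∈ I) {a : L.Arc}
    (ha : L.OnArc (shift θ s) a) : L.OnArc (shift θ t) a := by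
  obtain ⟨h, rfl⟩ := ha
  refine ⟨hu t ht, ?_⟩
  have hc : Continuous (fun x : I => (⟨shift θ x, hu x x.2⟩ : {θ // ¬ L.IsUnder θ})) :=
    ((continuous_shift θ).comp continuous_subtype_val).subtype_mk _
  have : PreconnectedSpace I := Subtype.preconnectedSpace hI
  rw [ConnectedComponents.coe_eq_coe']
  exact (isPreconnected_range hc).subset_connectedComponent ⟨⟨s, hs⟩, rfl⟩ ⟨⟨t, ht⟩, rfl⟩

lemma OnArc.unique {θ : Fin n × UnitAddCircle} {a b : L.Arc} (ha : L.OnArc θ a)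
    (hb : L.OnArc θ b) : a = b := by
  obtain ⟨_, rfl⟩ := ha
  obtain ⟨_, rfl⟩ := hb
  rfl

/-! ### Functions on local parametrizations -/

/-- A function that is locally constant off the graph is constant on convex pieces of a box that
avoid the graph. -/
lemma const_of_convex {X : Type*} {Ψ : OpenPartialHomeomorph Plane S} {f : S → X}
    {K : Set Plane} (hK : Convex ℝ K)
    (hKs : K ⊆ Ψ.source) (hf : ∀ z ∈ K, ∀ᶠ y in 𝓝 (Ψ z), f y = f (Ψ z)) {z z' : Plane}
    (hz : z ∈ K) (hz' : z' ∈ K) : f (Ψ z) = f (Ψ z') := by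
  let _ : TopologicalSpace X := ⊥
  have : DiscreteTopology X := ⟨rfl⟩
  refine hK.isPreconnected.constant (f := fun z => f (Ψ z)) ?_ hz hz'
  intro y hy
  refine ContinuousAt.continuousWithinAt ?_
  rw [ContinuousAt, nhds_discrete X, tendsto_pure]
  exact (Ψ.continuousAt (hKs hy)).eventually (hf y hy)

/-- The function `f` takes the values `A`, `B`, `C`, `D` on the open quadrants of a box that lie
to the right and to the left of the first axis, on its positive part and on its negative part. -/
def HasQuadrants {X : Type*} (r : ℝ) (Ψ : OpenPartialHomeomorph Plane S) (f : S → X)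
    (A B C D : X) : Prop :=
  ∀ z ∈ Metric.ball (0 : Plane) r,
    (0 < z 0 → z 1 < 0 → f (Ψ z) = A) ∧ (0 < z 0 → 0 < z 1 → f (Ψ z) = B) ∧
    (z 0 < 0 → z 1 < 0 → f (Ψ z) = C) ∧ (z 0 < 0 → 0 < z 1 → f (Ψ z) = D)

lemma HasQuadrants.comp {X Y : Type*} {r : ℝ} {Ψ : OpenPartialHomeomorph Plane S} {f : S → X}
    {A B C D : X}     (h : HasQuadrants r Ψ f A B C D) (g : X → Y) :
    HasQuadrants r Ψ (fun q => g (f q)) (g A) (g B) (g C) (g D) := fun z hz =>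
  ⟨fun h0 h1 => congrArg g ((h z hz).1 h0 h1), fun h0 h1 => congrArg g ((h z hz).2.1 h0 h1),
    fun h0 h1 => congrArg g ((h z hz).2.2.1 h0 h1), fun h0 h1 => congrArg g ((h z hz).2.2.2 h0 h1)⟩

lemma eventually_symm_eq {X : Type*} {Ψ : OpenPartialHomeomorph Plane S} (F : Plane → X)
    {z : Plane} (hz : z ∈ Ψ.source) (hF : ∀ᶠ y in 𝓝 z, F y = F z) :
    ∀ᶠ q in 𝓝 (Ψ z), F (Ψ.symm q) = F (Ψ.symm (Ψ z)) := by
  rw [Ψ.left_inv hz]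
  have h := Ψ.continuousAt_symm (Ψ.map_source hz)
  rw [ContinuousAt, Ψ.left_inv hz] at h
  exact h.eventually hF

variable [ChartedSpace Plane S]

lemma IsCrossing.not_isUnder (hL : L.InGeneralPosition) {o u : Fin n × UnitAddCircle}
    (h : L.IsCrossing o u) : ¬ L.IsUnder o := by
  rintro ⟨o', ho, hlt⟩
  rcases hL.no_triple o' o u ho h.1 with rfl | rfl | rfl
  · exact lt_irrefl _ hlt
  · exact h.ne rfl
  · exact lt_asymm hlt h.2

/-! ### Boxes -/

variable {θ o u : Fin n × UnitAddCircle} {T : ℝ → Set (Fin n × UnitAddCircle)} {r σ : ℝ}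
  {Ψ : OpenPartialHomeomorph Plane S}

namespace IsBox

lemma zero_mem (hb : L.IsBox θ T r Ψ) : (0 : Plane) ∈ Ψ.source := by
  rw [hb.source_eq]; simpa using hb.pos

lemma axis_left_mem (hb : L.IsBox θ T r Ψ) {s : ℝ} (hs : |s| < r) : !₂[s, 0] ∈ Ψ.source := by
  rw [hb.source_eq]; simpa [norm_axis_left] using hs

lemma axis_right_mem (hb : L.IsBox θ T r Ψ) {s : ℝ} (hs : |s| < r) : !₂[0, s] ∈ Ψ.source := by
  rw [hb.source_eq]; simpa [norm_axis_right] using hs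

lemma proj_shift (hb : L.IsBox θ T r Ψ) {s : ℝ} (hs : |s| < r) :
    L.proj (shift θ s) = Ψ !₂[s, 0] :=
  (hb.proj_eq_iff _ (by rw [← hb.source_eq]; exact hb.axis_left_mem hs) _).2 (Or.inl (by simp))

lemma proj_eq (hb : L.IsBox θ T r Ψ) : L.proj θ = Ψ 0 := by
  have := hb.proj_shift (s := 0) (by simpa using hb.pos)
  rw [shift_zero] at this
  rw [this]; congr 1; ext i; fin_cases i <;> simp

lemma target_mem_nhds (hb : L.IsBox θ T r Ψ) : Ψ.target ∈ 𝓝 (L.proj θ) := by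
  rw [hb.proj_eq]
  exact Ψ.open_target.mem_nhds (Ψ.map_source hb.zero_mem)

lemma exists_eq (hb : L.IsBox θ T r Ψ) {q : S} (hq : q ∈ Ψ.target) :
    ∃ z ∈ Metric.ball (0 : Plane) r, Ψ z = q :=
  ⟨Ψ.symm q, by rw [← hb.source_eq]; exact Ψ.map_target hq, Ψ.right_inv hq⟩

lemma coord_lt {z : Plane} (hz : z ∈ Metric.ball (0 : Plane) r) (i : Fin 2) : |z i| < r :=
  lt_of_le_of_lt (PiLp.norm_apply_le z i) (by simpa using hz)

lemma mem_graph_iff (hb : L.IsBox θ T r Ψ) {z : Plane} (hz : z ∈ Metric.ball (0 : Plane) r) :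
    Ψ z ∈ L.underlyingGraph ↔ z 1 = 0 ∨ (z 0 = 0 ∧ (T (z 1)).Nonempty) := by
  constructor
  · rintro ⟨θ', h⟩
    rcases (hb.proj_eq_iff z hz θ').1 h with h | h
    · exact Or.inl h.1
    · exact Or.inr ⟨h.1, ⟨_, h.2⟩⟩
  · rintro (h | ⟨h, θ', hT⟩)
    · exact ⟨_, (hb.proj_eq_iff z hz _).2 (Or.inl ⟨h, rfl⟩)⟩
    · exact ⟨_, (hb.proj_eq_iff z hz _).2 (Or.inr ⟨h, hT⟩)⟩

lemma proj_shift_right (hb : L.IsBox o (fun t => {shift u (σ * t)}) r Ψ) {s : ℝ} (hs : |s| < r) :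
    L.proj (shift u (σ * s)) = Ψ !₂[0, s] :=
  (hb.proj_eq_iff _ (by rw [← hb.source_eq]; exact hb.axis_right_mem hs) _).2 (Or.inr (by simp))

lemma isSimplePoint_shift (hb : L.IsBox θ T r Ψ) {s : ℝ} (hs : |s| < r)
    (h : s = 0 → T 0 = ∅) : L.IsSimplePoint (shift θ s) := by
  intro θ' hθ'
  rw [hb.proj_shift hs, hb.proj_eq_iff _ (by rw [← hb.source_eq]; exact hb.axis_left_mem hs)] at hθ'
  simp only [Matrix.cons_val_zero, Matrix.cons_val_one, true_and] at hθ'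
  rcases hθ' with h' | ⟨h', h''⟩
  · exact h'
  · simp [h h'] at h''

lemma isSimplePoint_shift_right (hb : L.IsBox o (fun t => {shift u (σ * t)}) r Ψ) {s : ℝ}
    (hs : |s| < r) (h : s ≠ 0) : L.IsSimplePoint (shift u (σ * s)) := by
  intro θ' hθ'
  rw [hb.proj_shift_right hs,
    hb.proj_eq_iff _ (by rw [← hb.source_eq]; exact hb.axis_right_mem hs)] at hθ'
  simp only [Matrix.cons_val_zero, Matrix.cons_val_one, true_and] at hθ'
  rcases hθ' with ⟨h', -⟩ | h'
  · exact absurd h' h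
  · exact h'

/-- The complement of the strand in the box consists of two convex half-discs. -/
lemma exists_halves (hb : L.IsBox θ (fun _ => ∅) r Ψ) {X : Type*} {f : S → X}
    (hf : ∀ q ∈ Ψ.target, q ∉ L.underlyingGraph → ∀ᶠ y in 𝓝 q, f y = f q) :
    ∃ hp hm, ∀ z ∈ Metric.ball (0 : Plane) r,
      (0 < z 1 → f (Ψ z) = hp) ∧ (z 1 < 0 → f (Ψ z) = hm) := by
  have hlin : IsLinearMap ℝ (fun z : Plane => z 1) := ⟨fun _ _ => rfl, fun _ _ => rfl⟩
  have key : ∀ K ⊆ Metric.ball (0 : Plane) r, Convex ℝ K → (∀ z ∈ K, z 1 ≠ 0) →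
      ∀ z ∈ K, ∀ z' ∈ K, f (Ψ z) = f (Ψ z') := by
    intro K hKb hK hK1 z hz z' hz'
    refine const_of_convex hK (by rw [hb.source_eq]; exact hKb) (fun y hy => ?_) hz hz'
    refine hf _ (Ψ.map_source (by rw [hb.source_eq]; exact hKb hy)) ?_
    rw [hb.mem_graph_iff (hKb hy)]
    simpa using hK1 y hy
  have hr2 : |r / 2| < r := by rw [abs_of_pos (half_pos hb.pos)]; exact half_lt_self hb.pos
  have hbp : !₂[0, r / 2] ∈ Metric.ball (0 : Plane) r := by
    rw [← hb.source_eq]; exact hb.axis_right_mem hr2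
  have hbm : !₂[0, -(r / 2)] ∈ Metric.ball (0 : Plane) r := by
    rw [← hb.source_eq]; exact hb.axis_right_mem (by rwa [abs_neg])
  refine ⟨f (Ψ !₂[0, r / 2]), f (Ψ !₂[0, -(r / 2)]), fun z hz => ⟨fun hz1 => ?_, fun hz1 => ?_⟩⟩
  · exact key (Metric.ball 0 r ∩ {z | 0 < z 1}) inter_subset_left
      ((convex_ball 0 r).inter (convex_halfSpace_gt hlin 0)) (fun y hy => hy.2.ne') z ⟨hz, hz1⟩ _
      ⟨hbp, by simpa using hb.pos⟩
  · exact key (Metric.ball 0 r ∩ {z | z 1 < 0}) inter_subset_left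
      ((convex_ball 0 r).inter (convex_halfSpace_lt hlin 0)) (fun y hy => hy.2.ne) z ⟨hz, hz1⟩ _
      ⟨hbm, by simpa using hb.pos⟩

/-- The open quadrants of the disc are convex and avoid the graph. This holds for every `T`, whether
or not the second axis belongs to the diagram. -/
lemma exists_quadrants (hb : L.IsBox θ T r Ψ) {X : Type*} {f : S → X}
    (hf : ∀ q ∈ Ψ.target, q ∉ L.underlyingGraph → ∀ᶠ y in 𝓝 q, f y = f q) :
    ∃ A B C D, HasQuadrants r Ψ f A B C D := by
  have hlin0 : IsLinearMap ℝ (fun z : Plane => z 0) := ⟨fun _ _ => rfl, fun _ _ => rfl⟩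
  have hlin1 : IsLinearMap ℝ (fun z : Plane => z 1) := ⟨fun _ _ => rfl, fun _ _ => rfl⟩
  have key : ∀ K ⊆ Metric.ball (0 : Plane) r, Convex ℝ K → (∀ z ∈ K, z 0 ≠ 0 ∧ z 1 ≠ 0) →
      ∃ h, ∀ z ∈ K, f (Ψ z) = h := by
    intro K hKb hK hK1
    rcases K.eq_empty_or_nonempty with rfl | ⟨z', hz'⟩
    · exact ⟨f (Ψ 0), by simp⟩
    refine ⟨f (Ψ z'), fun z hz => ?_⟩
    refine const_of_convex hK (by rw [hb.source_eq]; exact hKb) (fun y hy => ?_) hz hz'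
    refine hf _ (Ψ.map_source (by rw [hb.source_eq]; exact hKb hy)) ?_
    rw [hb.mem_graph_iff (hKb hy)]
    simp [hK1 y hy]
  obtain ⟨A, hA⟩ := key (Metric.ball 0 r ∩ ({z | 0 < z 0} ∩ {z | z 1 < 0})) inter_subset_left
    ((convex_ball 0 r).inter ((convex_halfSpace_gt hlin0 0).inter (convex_halfSpace_lt hlin1 0)))
    (fun y hy => ⟨hy.2.1.ne', hy.2.2.ne⟩)
  obtain ⟨B, hB⟩ := key (Metric.ball 0 r ∩ ({z | 0 < z 0} ∩ {z | 0 < z 1})) inter_subset_left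
    ((convex_ball 0 r).inter ((convex_halfSpace_gt hlin0 0).inter (convex_halfSpace_gt hlin1 0)))
    (fun y hy => ⟨hy.2.1.ne', hy.2.2.ne'⟩)
  obtain ⟨C, hC⟩ := key (Metric.ball 0 r ∩ ({z | z 0 < 0} ∩ {z | z 1 < 0})) inter_subset_left
    ((convex_ball 0 r).inter ((convex_halfSpace_lt hlin0 0).inter (convex_halfSpace_lt hlin1 0)))
    (fun y hy => ⟨hy.2.1.ne, hy.2.2.ne⟩)
  obtain ⟨D, hD⟩ := key (Metric.ball 0 r ∩ ({z | z 0 < 0} ∩ {z | 0 < z 1})) inter_subset_left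
    ((convex_ball 0 r).inter ((convex_halfSpace_lt hlin0 0).inter (convex_halfSpace_gt hlin1 0)))
    (fun y hy => ⟨hy.2.1.ne, hy.2.2.ne'⟩)
  exact ⟨A, B, C, D, fun z hz => ⟨fun h0 h1 => hA z ⟨hz, h0, h1⟩, fun h0 h1 => hB z ⟨hz, h0, h1⟩,
    fun h0 h1 => hC z ⟨hz, h0, h1⟩, fun h0 h1 => hD z ⟨hz, h0, h1⟩⟩⟩

variable {G : Type*} [Group G] {f : S → G}

lemma hasJump_shift_iff (hb : L.IsBox θ T r Ψ) {s : ℝ} (hs : |s| < r) {hp hm x : G}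
    (hleft : ∀ᶠ y : Plane in 𝓝 !₂[s, 0], 0 < y 1 → f (Ψ y) = hp)
    (hright : ∀ᶠ y : Plane in 𝓝 !₂[s, 0], y 1 < 0 → f (Ψ y) = hm) :
    L.HasJump f (shift θ s) x ↔ hp = hm * x := by
  refine hasJump_iff hb.oriented (hb.axis_left_mem hs) (u := !₂[1, 0])
    (fun h => by simpa using congrArg (fun z : Plane => z 0) h) ?_ ?_ ?_
  · have hev : ∀ᶠ ε : ℝ in 𝓝 0, |s + ε| < r := by
      have : ContinuousAt (fun ε : ℝ => |s + ε|) 0 := by fun_prop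
      exact this.eventually (gt_mem_nhds (by simpa using hs))
    filter_upwards [hev] with ε hε
    rw [shift_shift, hb.proj_shift hε]
    congr 1; ext i; fin_cases i <;> simp
  · simpa [cross] using hleft
  · simpa [cross] using hright

lemma hasJump_shift_right_iff (hb : L.IsBox o (fun t => {shift u (σ * t)}) r Ψ) (hσ : σ * σ = 1)
    {t : ℝ} (ht : |t| < r) {hp hm x : G}
    (hleft : ∀ᶠ y : Plane in 𝓝 !₂[0, t], σ * y 0 < 0 → f (Ψ y) = hp)
    (hright : ∀ᶠ y : Plane in 𝓝 !₂[0, t], 0 < σ * y 0 → f (Ψ y) = hm) :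
    L.HasJump f (shift u (σ * t)) x ↔ hp = hm * x := by
  refine hasJump_iff hb.oriented (hb.axis_right_mem ht) (u := !₂[0, σ])
    (fun h => ?_) ?_ ?_ ?_
  · have : σ = 0 := by simpa using congrArg (fun z : Plane => z 1) h
    simp [this] at hσ
  · have hev : ∀ᶠ ε : ℝ in 𝓝 0, |t + σ * ε| < r := by
      have : ContinuousAt (fun ε : ℝ => |t + σ * ε|) 0 := by fun_prop
      exact this.eventually (gt_mem_nhds (by simpa using ht))
    filter_upwards [hev] with ε hε
    have h1 : σ * t + ε = σ * (t + σ * ε) := by linear_combination -ε * hσ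
    rw [shift_shift, h1, hb.proj_shift_right hε]
    congr 1; ext i; fin_cases i <;> simp [mul_comm]
  · simpa [cross] using hleft
  · simpa [cross] using hright

lemma eventually_mem_ball {z : Plane} (hz : z ∈ Ψ.source) (hb : L.IsBox θ T r Ψ) :
    ∀ᶠ y : Plane in 𝓝 z, y ∈ Metric.ball (0 : Plane) r := by
  rw [hb.source_eq] at hz
  exact Metric.isOpen_ball.mem_nhds hz

lemma eventually_coord_pos (z : Plane) {i : Fin 2} (h : 0 < z i) :
    ∀ᶠ y : Plane in 𝓝 z, 0 < y i :=
  (by fun_prop : Continuous fun y : Plane => y i).continuousAt.eventually (lt_mem_nhds h)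

lemma eventually_coord_neg (z : Plane) {i : Fin 2} (h : z i < 0) :
    ∀ᶠ y : Plane in 𝓝 z, y i < 0 :=
  (by fun_prop : Continuous fun y : Plane => y i).continuousAt.eventually (gt_mem_nhds h)

variable {A B C D : G}

lemma hasJump_shift_pos_iff (hQ : HasQuadrants r Ψ f A B C D) (hb : L.IsBox θ T r Ψ) {s : ℝ}
    (hs : |s| < r) (hs0 : 0 < s) {x : G} :
    L.HasJump f (shift θ s) x ↔ B = A * x := by
  refine hb.hasJump_shift_iff hs ?_ ?_ <;>
  filter_upwards [eventually_mem_ball (hb.axis_left_mem hs) hb,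
    eventually_coord_pos !₂[s, 0] (i := 0) (by simpa using hs0)] with y hy hy0 hy1
  · exact (hQ y hy).2.1 hy0 hy1
  · exact (hQ y hy).1 hy0 hy1

lemma hasJump_shift_neg_iff (hQ : HasQuadrants r Ψ f A B C D) (hb : L.IsBox θ T r Ψ) {s : ℝ}
    (hs : |s| < r) (hs0 : s < 0) {x : G} :
    L.HasJump f (shift θ s) x ↔ D = C * x := by
  refine hb.hasJump_shift_iff hs ?_ ?_ <;>
  filter_upwards [eventually_mem_ball (hb.axis_left_mem hs) hb,
    eventually_coord_neg !₂[s, 0] (i := 0) (by simpa using hs0)] with y hy hy0 hy1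
  · exact (hQ y hy).2.2.2 hy0 hy1
  · exact (hQ y hy).2.2.1 hy0 hy1

/-- In box coordinates the lower strand has velocity `σ` along the second axis, so its left side is
the part behind the crossing (`D`) for `σ = 1` and the part ahead (`B`) for `σ = -1`. -/
lemma hasJump_under_pos_iff (hQ : HasQuadrants r Ψ f A B C D) (hσ : σ = 1 ∨ σ = -1)
    (hb : L.IsBox o (fun t => {shift u (σ * t)}) r Ψ) {t : ℝ} (ht : |t| < r) (ht0 : 0 < t)
    {x : G} : L.HasJump f (shift u (σ * t)) x ↔ if σ = 1 then D = B * x else B = D * x := by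
  rcases hσ with rfl | rfl
  · rw [if_pos rfl]
    refine hb.hasJump_shift_right_iff (by norm_num) ht ?_ ?_ <;>
    filter_upwards [eventually_mem_ball (hb.axis_right_mem ht) hb,
      eventually_coord_pos !₂[0, t] (i := 1) (by simpa using ht0)] with y hy hy0 hy1
    · exact (hQ y hy).2.2.2 (by linarith) hy0
    · exact (hQ y hy).2.1 (by linarith) hy0
  · rw [if_neg (by norm_num)]
    refine hb.hasJump_shift_right_iff (by norm_num) ht ?_ ?_ <;>
    filter_upwards [eventually_mem_ball (hb.axis_right_mem ht) hb,
      eventually_coord_pos !₂[0, t] (i := 1) (by simpa using ht0)] with y hy hy0 hy1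
    · exact (hQ y hy).2.1 (by linarith) hy0
    · exact (hQ y hy).2.2.2 (by linarith) hy0

lemma hasJump_under_neg_iff (hQ : HasQuadrants r Ψ f A B C D) (hσ : σ = 1 ∨ σ = -1)
    (hb : L.IsBox o (fun t => {shift u (σ * t)}) r Ψ) {t : ℝ} (ht : |t| < r) (ht0 : t < 0)
    {x : G} : L.HasJump f (shift u (σ * t)) x ↔ if σ = 1 then C = A * x else A = C * x := by
  rcases hσ with rfl | rfl
  · rw [if_pos rfl]
    refine hb.hasJump_shift_right_iff (by norm_num) ht ?_ ?_ <;>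
    filter_upwards [eventually_mem_ball (hb.axis_right_mem ht) hb,
      eventually_coord_neg !₂[0, t] (i := 1) (by simpa using ht0)] with y hy hy0 hy1
    · exact (hQ y hy).2.2.1 (by linarith) hy0
    · exact (hQ y hy).1 (by linarith) hy0
  · rw [if_neg (by norm_num)]
    refine hb.hasJump_shift_right_iff (by norm_num) ht ?_ ?_ <;>
    filter_upwards [eventually_mem_ball (hb.axis_right_mem ht) hb,
      eventually_coord_neg !₂[0, t] (i := 1) (by simpa using ht0)] with y hy hy0 hy1
    · exact (hQ y hy).1 (by linarith) hy0
    · exact (hQ y hy).2.2.1 (by linarith) hy0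

end IsBox

end OrientedLink

end ThickenedSurface

/-! ### Local region colourings of an arc colouring. -/

namespace ThickenedSurface

namespace OrientedLink

variable {S : Type*} [TopologicalSpace S] {n : ℕ} {L : OrientedLink S n}
  [ChartedSpace Plane S] {G : Type*} [Group G]

variable (L) in
/-- At the point `p`, the function `f` is a region colouring with values in `G` for the arc
colouring `ρ`: it is locally constant off the graph, and changes by `ρ a` when the arc `a` is
crossed from right to left. -/
def IsColoringAt (ρ : L.Arc → G) (f : S → G) (p : S) : Prop :=
  (p ∉ L.underlyingGraph → ∀ᶠ y in 𝓝 p, f y = f p) ∧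
  ∀ θ a, L.proj θ = p → L.IsSimplePoint θ → L.OnArc θ a → L.HasJump f θ (ρ a)

variable (L) in
/-- The arc colouring `ρ` satisfies the Wirtinger relations. -/
def IsArcColoring (ρ : L.Arc → G) : Prop :=
  ∀ o u a b c, L.IsCrossing o u → L.OnArc o a → L.ArcNext u (L.crossingSign o u) b →
    L.ArcNext u (-L.crossingSign o u) c → ρ a * ρ b = ρ c * ρ a

/-- Values on the graph are irrelevant, as a transverse curve meets it only at the time of crossing,
and a constant left factor commutes with right multiplication by the jump. -/
lemma HasJump.congr {f f' : S → G} {θ : Fin n × UnitAddCircle} {x : G} (h : L.HasJump f θ x)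
    (g : G) (he : ∀ᶠ y in 𝓝[L.underlyingGraphᶜ] L.proj θ, f' y = g * f y)
    (hs : ∀ (c : ℝ → S) (t : ℝ), c t = L.proj θ → ContinuousAt c t →
      cross (L.velocity θ) (curveVelocity c t) ≠ 0 →
      ∀ᶠ s in 𝓝[≠] t, c s ∉ L.underlyingGraph) : L.HasJump f' θ x := by
  intro c t hct hc hpos
  obtain ⟨h, h1, h2⟩ := h c t hct hc hpos
  have hev : ∀ᶠ s in 𝓝[≠] t, f' (c s) = g * f (c s) := by
    refine Tendsto.eventually (tendsto_nhdsWithin_iff.2 ⟨?_, hs c t hct hc hpos.ne'⟩) he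
    rw [← hct]; exact hc.tendsto.mono_left nhdsWithin_le_nhds
  refine ⟨g * h, ?_, ?_⟩
  · filter_upwards [h1, hev.filter_mono (nhdsWithin_mono t (s := Iio t) fun s hs => ne_of_lt hs)]
      with s hs1 hs2
    rw [hs2, hs1]
  · filter_upwards [h2, hev.filter_mono (nhdsWithin_mono t (s := Ioi t) fun s hs => ne_of_gt hs)]
      with s hs1 hs2
    rw [hs2, hs1, mul_assoc]

lemma HasJump.map {G' : Type*} [Group G'] (φ : G →* G') {f : S → G}
    {θ : Fin n × UnitAddCircle} {x : G} (h : L.HasJump f θ x) :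
    L.HasJump (fun q => φ (f q)) θ (φ x) := by
  intro c t hct hc hpos
  obtain ⟨h, h1, h2⟩ := h c t hct hc hpos
  exact ⟨φ h, h1.mono fun s hs => congrArg φ hs,
    h2.mono fun s hs => (congrArg φ hs).trans (map_mul φ _ _)⟩

lemma IsColoringAt.map {G' : Type*} [Group G'] (φ : G →* G') {ρ : L.Arc → G} {f : S → G} {p : S}
    (h : L.IsColoringAt ρ f p) : L.IsColoringAt (fun a => φ (ρ a)) (fun q => φ (f q)) p :=
  ⟨fun hp => (h.1 hp).mono fun _ hy => congrArg φ hy, fun θ a h1 h2 h3 => (h.2 θ a h1 h2 h3).map φ⟩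

lemma IsBox.velocity_eq {θ : Fin n × UnitAddCircle} {T : ℝ → Set (Fin n × UnitAddCircle)} {r : ℝ}
    {Ψ : OpenPartialHomeomorph Plane S} (hb : L.IsBox θ T r Ψ) {D : Plane ≃L[ℝ] Plane}
    (hD : HasFDerivAt (fun y => chartAt Plane (Ψ 0) (Ψ y)) (D : Plane →L[ℝ] Plane) 0) :
    L.velocity θ = D !₂[1, 0] := by
  refine curveVelocity_comp hD (ζ := fun s : ℝ => s • !₂[1, 0]) (by simp)
    (by simpa using (hasDerivAt_id (0 : ℝ)).smul_const (!₂[1, 0] : Plane)) ?_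
  have : ∀ᶠ s : ℝ in 𝓝 0, |s| < r := by
    filter_upwards [Metric.ball_mem_nhds (0 : ℝ) hb.pos] with s hs
    simpa using hs
  filter_upwards [this] with s hs
  rw [hb.proj_shift hs]
  congr 1; ext i; fin_cases i <;> simp

lemma IsBox.velocity_right_eq {o u : Fin n × UnitAddCircle} {r σ : ℝ}
    {Ψ : OpenPartialHomeomorph Plane S} (hb : L.IsBox o (fun t => {shift u (σ * t)}) r Ψ)
    (hσ : σ * σ = 1) {D : Plane ≃L[ℝ] Plane}
    (hD : HasFDerivAt (fun y => chartAt Plane (Ψ 0) (Ψ y)) (D : Plane →L[ℝ] Plane) 0) :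
    L.velocity u = D !₂[0, σ] := by
  refine curveVelocity_comp hD (ζ := fun s : ℝ => s • !₂[0, σ]) (by simp)
    (by simpa using (hasDerivAt_id (0 : ℝ)).smul_const (!₂[0, σ] : Plane)) ?_
  have : ∀ᶠ s : ℝ in 𝓝 0, |σ * s| < r := by
    have : ContinuousAt (fun s : ℝ => |σ * s|) 0 := by fun_prop
    exact this.eventually (gt_mem_nhds (by simpa using hb.pos))
  filter_upwards [this] with s hs
  have h := hb.proj_shift_right hs
  rw [← mul_assoc, hσ, one_mul] at h
  rw [h]
  congr 1; ext i; fin_cases i <;> simp [mul_comm]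

lemma eventually_ite_coord_eq {X : Type*} (z : Plane) {i : Fin 2} (h : z i ≠ 0) (a b : X) :
    ∀ᶠ y : Plane in 𝓝 z, (if 0 < y i then a else b) = if 0 < z i then a else b := by
  rcases lt_or_gt_of_ne h with h | h
  · filter_upwards [IsBox.eventually_coord_neg z h] with y hy
    rw [if_neg hy.not_gt, if_neg h.not_gt]
  · filter_upwards [IsBox.eventually_coord_pos z h] with y hy
    rw [if_pos hy, if_pos h]

/-- The upper strand runs through the crossing as one arc, while the lower one is broken at `u`
only. The factor `σ` puts `b` on the left and `c` on the right of the upper strand. -/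
lemma IsBox.exists_arcs {o u : Fin n × UnitAddCircle} {r σ : ℝ} (hL : L.InGeneralPosition)
    (ho : L.IsCrossing o u)
    {Ψ : OpenPartialHomeomorph Plane S} (hb : L.IsBox o (fun t => {shift u (σ * t)}) r Ψ) :
    ∃ a b c, (∀ s, |s| < r → L.OnArc (shift o s) a) ∧
      (∀ t, |t| < r → 0 < t → L.OnArc (shift u (σ * t)) b) ∧
      ∀ t, |t| < r → t < 0 → L.OnArc (shift u (σ * t)) c := by
  have hr := hb.pos
  have h1 : ∀ s ∈ Metric.ball (0 : ℝ) r, ¬ L.IsUnder (shift o s) := by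
    intro s hs
    by_cases h0 : s = 0
    · subst h0; rw [shift_zero]; exact ho.not_isUnder hL
    · exact (hb.isSimplePoint_shift (by simpa using hs) fun h => absurd h h0).not_isUnder
  have h2 : ∀ s ∈ (fun t => σ * t) '' Ioo 0 r, ¬ L.IsUnder (shift u s) := by
    rintro _ ⟨t, ht, rfl⟩
    exact (hb.isSimplePoint_shift_right (by rw [abs_of_pos ht.1]; exact ht.2) ht.1.ne').not_isUnder
  have h3 : ∀ s ∈ (fun t => σ * t) '' Ioo (-r) 0, ¬ L.IsUnder (shift u s) := by
    rintro _ ⟨t, ht, rfl⟩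
    exact (hb.isSimplePoint_shift_right (by rw [abs_of_neg ht.2]; linarith [ht.1])
      ht.2.ne).not_isUnder
  have hp2 : IsPreconnected ((fun t => σ * t) '' Ioo 0 r) :=
    isPreconnected_Ioo.image _ (by fun_prop)
  have hp3 : IsPreconnected ((fun t => σ * t) '' Ioo (-r) 0) :=
    isPreconnected_Ioo.image _ (by fun_prop)
  have m2 : σ * (r / 2) ∈ (fun t => σ * t) '' Ioo 0 r := ⟨_, ⟨by linarith, by linarith⟩, rfl⟩
  have m3 : σ * (-r / 2) ∈ (fun t => σ * t) '' Ioo (-r) 0 := ⟨_, ⟨by linarith, by linarith⟩, rfl⟩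
  refine ⟨ConnectedComponents.mk ⟨_, h1 0 (by simpa using hr)⟩,
    ConnectedComponents.mk ⟨_, h2 _ m2⟩, ConnectedComponents.mk ⟨_, h3 _ m3⟩, ?_, ?_, ?_⟩
  · intro s hs
    exact onArc_of_isPreconnected (Metric.isPreconnected_ball) h1 (by simpa using hr)
      (by simpa using hs) ⟨_, rfl⟩
  · intro t ht h0
    exact onArc_of_isPreconnected hp2 h2 m2 ⟨t, ⟨h0, lt_of_abs_lt ht⟩, rfl⟩ ⟨_, rfl⟩
  · intro t ht h0
    exact onArc_of_isPreconnected hp3 h3 m3 ⟨t, ⟨neg_lt_of_abs_lt ht, h0⟩, rfl⟩ ⟨_, rfl⟩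

lemma IsBox.onArc_shift {θ : Fin n × UnitAddCircle} {r : ℝ} {Ψ : OpenPartialHomeomorph Plane S}
    (hb : L.IsBox θ (fun _ => ∅) r Ψ) {a : L.Arc} (ha : L.OnArc θ a) {s : ℝ} (hs : |s| < r) :
    L.OnArc (shift θ s) a := by
  refine onArc_of_isPreconnected (Metric.isPreconnected_ball (x := (0 : ℝ)) (r := r))
    (fun t ht => (hb.isSimplePoint_shift (by simpa using ht) fun _ => rfl).not_isUnder) (s := 0)
    (by simpa using hb.pos) (by simpa using hs) (by rwa [shift_zero])

lemma eventually_pos_abs_lt {r : ℝ} (hr : 0 < r) : ∀ᶠ ε : ℝ in 𝓝[>] 0, 0 < ε ∧ |ε| < r := by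
  filter_upwards [Ioo_mem_nhdsGT hr] with ε hε
  exact ⟨hε.1, by rw [abs_of_pos hε.1]; exact hε.2⟩

variable [T2Space S] [IsManifold (𝓡 2) ∞ S]

lemma exists_box_of_mem (hS : IsOrientedAtlas S) (hL : L.InGeneralPosition) {p : S}
    (hp : p ∈ L.underlyingGraph) {U : Set S} (hU : U ∈ 𝓝 p) :
    (∃ θ r Ψ, L.IsSimplePoint θ ∧ L.proj θ = p ∧ L.IsBox θ (fun _ => ∅) r Ψ ∧ Ψ.target ⊆ U) ∨
    ∃ o u r Ψ, L.IsCrossing o u ∧ L.proj o = p ∧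
      L.IsBox o (fun t => {shift u (L.crossingSign o u * t)}) r Ψ ∧ Ψ.target ⊆ U := by
  obtain ⟨θ, rfl⟩ := hp
  by_cases hθ : L.IsSimplePoint θ
  · obtain ⟨r, Ψ, hb, hs⟩ := exists_simpleBox hS hL hθ hU
    exact Or.inl ⟨θ, r, Ψ, hθ, rfl, hb, hs⟩
  · right
    by_cases hu : L.IsUnder θ
    · obtain ⟨o, ho⟩ := hu
      obtain ⟨r, Ψ, hb, hs⟩ := exists_crossingBox hS hL ho.ne ho.1 (by rw [ho.1]; exact hU)
      exact ⟨o, θ, r, Ψ, ho, ho.1, hb, hs⟩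
    · obtain ⟨u, hu⟩ := exists_isCrossing_of_not_isSimplePoint hθ hu
      obtain ⟨r, Ψ, hb, hs⟩ := exists_crossingBox hS hL hu.ne hu.1 hU
      exact ⟨θ, u, r, Ψ, hu, rfl, hb, hs⟩

/-- The diagram occupies at most the axes of a box. Density is what makes the factor between two
colourings unique near every point, even on the graph. -/
lemma dense_compl_underlyingGraph (hS : IsOrientedAtlas S) (hL : L.InGeneralPosition) (p : S) :
    (𝓝[L.underlyingGraphᶜ] p).NeBot := by
  rw [← mem_closure_iff_nhdsWithin_neBot, mem_closure_iff_nhds]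
  intro U hU
  by_cases hp : p ∈ L.underlyingGraph
  · have key : ∀ (θ : Fin n × UnitAddCircle) (T : ℝ → Set (Fin n × UnitAddCircle)) (r : ℝ)
        (Ψ : OpenPartialHomeomorph Plane S), L.IsBox θ T r Ψ → Ψ.target ⊆ U →
        (U ∩ L.underlyingGraphᶜ).Nonempty := by
      intro θ T r Ψ hb hs
      have hz : !₂[r / 2, r / 2] ∈ Metric.ball (0 : Plane) r := by
        have hr := hb.pos
        rw [mem_ball_zero_iff, EuclideanSpace.norm_eq, Real.sqrt_lt' hr]
        simp
        nlinarith
      refine ⟨Ψ !₂[r / 2, r / 2], hs (Ψ.map_source (by rw [hb.source_eq]; exact hz)), ?_⟩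
      rw [mem_compl_iff, hb.mem_graph_iff hz]
      simp [hb.pos.ne']
    rcases exists_box_of_mem hS hL hp hU with ⟨θ, r, Ψ, -, -, hb, hs⟩ | ⟨o, u, r, Ψ, -, -, hb, hs⟩
    · exact key _ _ _ _ hb hs
    · exact key _ _ _ _ hb hs
  · exact ⟨p, mem_of_mem_nhds hU, hp⟩

/-- A curve that crosses the diagram transversely at a simple point meets it in no other nearby
point. -/
lemma eventually_notMem_of_transverse (hS : IsOrientedAtlas S) (hL : L.InGeneralPosition)
    {θ : Fin n × UnitAddCircle} (hθ : L.IsSimplePoint θ) {c : ℝ → S} {t : ℝ}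
    (hct : c t = L.proj θ) (hc : ContinuousAt c t)
    (hne : cross (L.velocity θ) (curveVelocity c t) ≠ 0) :
    ∀ᶠ s in 𝓝[≠] t, c s ∉ L.underlyingGraph := by
  obtain ⟨r, Ψ, hb, -⟩ := exists_simpleBox hS hL hθ univ_mem
  obtain ⟨D, hDpos, hD⟩ := hb.oriented 0 hb.zero_mem
  have hV0 : curveVelocity c t ≠ 0 := by
    intro h0; rw [h0] at hne; simp [cross] at hne
  have hV := hasDerivAt_of_curveVelocity_ne_zero hV0
  obtain ⟨w, hw⟩ := D.surjective (curveVelocity c t)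
  rw [hb.velocity_eq hD, ← hw, ← ContinuousLinearEquiv.coe_coe, cross_map] at hne
  rw [← hw] at hV
  obtain ⟨ε, hε⟩ : ∃ ε : ℝ, 0 < cross (ε • !₂[1, 0]) w := by
    refine ⟨cross !₂[1, 0] w, ?_⟩
    rw [cross_smul_left]
    exact mul_self_pos.2 (right_ne_zero_of_mul hne)
  have hmem : ∀ᶠ y in 𝓝 (0 : Plane), y 1 ≠ 0 → Ψ y ∉ L.underlyingGraph := by
    filter_upwards [IsBox.eventually_mem_ball hb.zero_mem hb] with y hy hy1
    rw [hb.mem_graph_iff hy]; simp [hy1]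
  obtain ⟨h1, h2⟩ := eventually_side (P := fun q => q ∉ L.underlyingGraph)
    (Q := fun q => q ∉ L.underlyingGraph) hb.zero_mem hD (hct.trans hb.proj_eq) hc hV hε
    (hmem.mono fun y hy hpos => hy (by rintro h0; simp [cross, h0] at hpos))
    (hmem.mono fun y hy hpos => hy (by rintro h0; simp [cross, h0] at hpos))
  rw [← nhdsLT_sup_nhdsGT]
  exact eventually_sup.2 ⟨h2, h1⟩

/-- Region colourings exist locally. -/
lemma exists_isColoringAt (hS : IsOrientedAtlas S) (hL : L.InGeneralPosition) {ρ : L.Arc → G}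
    (hρ : L.IsArcColoring ρ) (p : S) : ∃ f : S → G, ∀ᶠ q in 𝓝 p, L.IsColoringAt ρ f q := by
  by_cases hp : p ∈ L.underlyingGraph
  swap
  · refine ⟨fun _ => 1, ?_⟩
    filter_upwards [L.isClosed_underlyingGraph.isOpen_compl.mem_nhds hp] with q hq
    exact ⟨fun _ => by simp, fun θ a h => absurd ⟨θ, h⟩ hq⟩
  rcases exists_box_of_mem hS hL hp univ_mem with
    ⟨θ, r, Ψ, hθ, rfl, hb, -⟩ | ⟨o, u, r, Ψ, ho, rfl, hb, -⟩
  · set a : L.Arc := ConnectedComponents.mk ⟨θ, hθ.not_isUnder⟩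
    set F : Plane → G := fun z => if 0 < z 1 then ρ a else 1 with hF
    refine ⟨fun q => F (Ψ.symm q), ?_⟩
    filter_upwards [hb.target_mem_nhds] with q hq
    obtain ⟨z, hz, rfl⟩ := hb.exists_eq hq
    have hzs : z ∈ Ψ.source := by rw [hb.source_eq]; exact hz
    refine ⟨fun hng => ?_, ?_⟩
    · rw [hb.mem_graph_iff hz] at hng
      push Not at hng
      exact eventually_symm_eq F hzs (eventually_ite_coord_eq z hng.1 _ _)
    · rintro θ' a' hθ' - ha'
      rw [hb.proj_eq_iff z hz] at hθ'
      simp only [mem_empty_iff_false, and_false, or_false] at hθ'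
      obtain ⟨hz1, rfl⟩ := hθ'
      have hz0 := IsBox.coord_lt hz 0
      rw [ha'.unique (hb.onArc_shift ⟨hθ.not_isUnder, rfl⟩ hz0)]
      refine (hb.hasJump_shift_iff hz0 (hp := ρ a) (hm := 1) ?_ ?_).2 (by simp [a]) <;>
      filter_upwards [IsBox.eventually_mem_ball (hb.axis_left_mem hz0) hb] with y hy hy1
      · simp [hF, Ψ.left_inv (by rw [hb.source_eq]; exact hy), hy1]
      · simp [hF, Ψ.left_inv (by rw [hb.source_eq]; exact hy), hy1.not_gt]
  · have hσ := crossingSign_eq_or hL ho.ne ho.1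
    obtain ⟨a, b, c, ha, hb', hc⟩ := hb.exists_arcs hL ho
    have hrel : ρ a * ρ b = ρ c * ρ a := by
      refine hρ o u a b c ho ?_ ?_ ?_
      · simpa [shift_zero] using ha 0 (by simpa using hb.pos)
      · filter_upwards [eventually_pos_abs_lt hb.pos] with ε hε using hb' ε hε.2 hε.1
      · filter_upwards [eventually_pos_abs_lt hb.pos] with ε hε
        simpa using hc (-ε) (by simpa using hε.2) (by linarith [hε.1])
    set σ := L.crossingSign o u
    -- The value behind the crossing on the right, forced by the jump across `c` when the value
    -- ahead on the right is `1`; crossing `c` backwards goes from right to left if `σ = 1` and from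
    -- left to right otherwise.
    set κ : G := if σ = 1 then ρ c else (ρ c)⁻¹ with hκ
    set F : Plane → G := fun z => (if 0 < z 0 then 1 else κ) * (if 0 < z 1 then ρ a else 1)
      with hF
    have hQ : HasQuadrants r Ψ (fun q => F (Ψ.symm q)) 1 (ρ a) κ (κ * ρ a) := by
      intro z hz
      have hzs : z ∈ Ψ.source := by rw [hb.source_eq]; exact hz
      simp only [Ψ.left_inv hzs, hF]
      refine ⟨fun h0 h1 => ?_, fun h0 h1 => ?_, fun h0 h1 => ?_, fun h0 h1 => ?_⟩
      · simp [h0, h1.not_gt]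
      · simp [h0, h1]
      · simp [h0.not_gt, h1.not_gt]
      · simp [h0.not_gt, h1]
    refine ⟨fun q => F (Ψ.symm q), ?_⟩
    filter_upwards [hb.target_mem_nhds] with q hq
    obtain ⟨z, hz, rfl⟩ := hb.exists_eq hq
    have hzs : z ∈ Ψ.source := by rw [hb.source_eq]; exact hz
    refine ⟨fun hng => ?_, ?_⟩
    · rw [hb.mem_graph_iff hz] at hng
      simp only [singleton_nonempty, and_true, not_or] at hng
      refine eventually_symm_eq F hzs ?_
      filter_upwards [eventually_ite_coord_eq z hng.1 (ρ a) 1,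
        eventually_ite_coord_eq z hng.2 1 κ] with y h1 h2
      simp only [hF, h1, h2]
    · rintro θ' a' hθ' hs ha'
      have hz0 := IsBox.coord_lt hz 0
      have hz1 := IsBox.coord_lt hz 1
      have hne : z 0 = 0 → z 1 = 0 → False := by
        intro h0 h1
        have hzz : z = 0 := by ext i; fin_cases i <;> simp [h0, h1]
        rw [hzz, ← hb.proj_eq] at hθ'
        exact ho.ne ((hs o hθ'.symm).trans (hs u (by rw [← ho.1, hθ'])).symm)
      rw [hb.proj_eq_iff z hz] at hθ'
      rcases hθ' with ⟨h1, rfl⟩ | ⟨h0, hT⟩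
      · rw [ha'.unique (ha _ hz0)]
        rcases lt_trichotomy (z 0) 0 with h | h | h
        · exact (IsBox.hasJump_shift_neg_iff hQ hb hz0 h).2 rfl
        · exact (hne h h1).elim
        · exact (IsBox.hasJump_shift_pos_iff hQ hb hz0 h).2 (by simp)
      · rw [mem_singleton_iff] at hT
        subst hT
        rcases lt_trichotomy (z 1) 0 with h | h | h
        · rw [ha'.unique (hc _ hz1 h)]
          refine (IsBox.hasJump_under_neg_iff hQ hσ hb hz1 h).2 ?_
          split_ifs with h1 <;> simp [hκ, h1]
        · exact (hne h0 h).elim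
        · rw [ha'.unique (hb' _ hz1 h)]
          refine (IsBox.hasJump_under_pos_iff hQ hσ hb hz1 h).2 ?_
          split_ifs with h1
          -- Three of the four jumps hold by construction; the remaining one, across `b`, is the
          -- Wirtinger relation.
          · simp [hκ, h1, hrel]
          · simp [hκ, h1, mul_assoc, hrel]

end OrientedLink

end ThickenedSurface

namespace ThickenedSurface

namespace OrientedLink

variable {S : Type*} [TopologicalSpace S] {n : ℕ} {L : OrientedLink S n}

/-! ### Regions -/

variable (L) in
/-- The region of a point off the graph. -/
def regionOf (R₀ : L.Region) (q : S) : L.Region :=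
  open scoped Classical in
  if h : q ∉ L.underlyingGraph then ConnectedComponents.mk ⟨q, h⟩ else R₀

lemma regionOf_of_notMem {R₀ : L.Region} {q : S} (hq : q ∉ L.underlyingGraph) :
    L.regionOf R₀ q = ConnectedComponents.mk ⟨q, hq⟩ := dif_pos hq

lemma inRegion_regionOf {R₀ : L.Region} {q : S} (hq : q ∉ L.underlyingGraph) :
    L.InRegion q (L.regionOf R₀ q) := ⟨hq, (regionOf_of_notMem hq).symm⟩

lemma InRegion.regionOf_eq {R₀ R : L.Region} {q : S} (h : L.InRegion q R) :
    L.regionOf R₀ q = R := by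
  obtain ⟨hq, rfl⟩ := h
  exact regionOf_of_notMem hq

/-- Functions that are locally constant off the graph are constant on regions. -/
lemma eq_of_inRegion {X : Type*} {f : S → X}
    (hf : ∀ q, q ∉ L.underlyingGraph → ∀ᶠ y in 𝓝 q, f y = f q) {q q' : S} {R : L.Region}
    (hq : L.InRegion q R) (hq' : L.InRegion q' R) : f q = f q' := by
  let _ : TopologicalSpace X := ⊥
  have : DiscreteTopology X := ⟨rfl⟩
  obtain ⟨h, rfl⟩ := hq
  obtain ⟨h', he⟩ := hq'
  have hc : Continuous (fun p : {p : S // p ∉ L.underlyingGraph} => f p) := by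
    rw [continuous_iff_continuousAt]
    intro p
    rw [ContinuousAt, nhds_discrete X, tendsto_pure]
    exact continuous_subtype_val.continuousAt.eventually (hf p p.2)
  have := congrArg hc.connectedComponentsLift he
  simpa using this.symm

variable [ChartedSpace Plane S]

/-- The surface is locally connected, so the components of the open complement of the graph are
open. -/
lemma eventually_regionOf_eq [T2Space S] {R₀ : L.Region} {q : S} (hq : q ∉ L.underlyingGraph) :
    ∀ᶠ y in 𝓝 q, L.regionOf R₀ y = L.regionOf R₀ q := by
  have hopen : IsOpen {p : S | p ∉ L.underlyingGraph} := L.isClosed_underlyingGraph.isOpen_compl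
  have : LocallyConnectedSpace S := ChartedSpace.locallyConnectedSpace Plane S
  have : LocallyConnectedSpace {p : S | p ∉ L.underlyingGraph} := hopen.locallyConnectedSpace
  have h1 : IsOpen (Subtype.val '' connectedComponent
      (⟨q, hq⟩ : {p : S // p ∉ L.underlyingGraph})) :=
    hopen.isOpenEmbedding_subtypeVal.isOpenMap _ (isOpen_connectedComponent (α := {p : S | p ∉ L.underlyingGraph}))
  filter_upwards [h1.mem_nhds ⟨⟨q, hq⟩, mem_connectedComponent, rfl⟩]
  rintro _ ⟨⟨y, hy⟩, hyc, rfl⟩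
  refine InRegion.regionOf_eq ⟨hy, ?_⟩
  exact (ConnectedComponents.coe_eq_coe'.2 hyc).trans (regionOf_of_notMem hq).symm

lemma RegionNext.unique {p : S} {v : Plane} {A B : L.Region} (hA : L.RegionNext p v A)
    (hB : L.RegionNext p v B) : A = B := by
  obtain ⟨ε, h1, h2⟩ := (hA.and hB).exists
  rw [← h1.regionOf_eq (R₀ := A), h2.regionOf_eq]

/-- Leaving the centre of a box with coordinate velocity `w` leads into the quadrant of `w`. -/
lemma IsBox.eventually_line {θ : Fin n × UnitAddCircle} {T : ℝ → Set (Fin n × UnitAddCircle)}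
    {r : ℝ} {Ψ : OpenPartialHomeomorph Plane S} (hb : L.IsBox θ T r Ψ) {D : Plane ≃L[ℝ] Plane}
    (hD : HasFDerivAt (fun y => chartAt Plane (Ψ 0) (Ψ y)) (D : Plane →L[ℝ] Plane) 0)
    {w : Plane} (h0 : w 0 ≠ 0) (h1 : w 1 ≠ 0) {P : S → Prop}
    (hP : ∀ z ∈ Metric.ball (0 : Plane) r, 0 < w 0 * z 0 → 0 < w 1 * z 1 → P (Ψ z)) :
    ∀ᶠ s in 𝓝[>] (0 : ℝ), P (line (L.proj θ) (D w) s) := by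
  set c := line (L.proj θ) (D w)
  have hc0 : c 0 = Ψ 0 := (line_zero _ _).trans hb.proj_eq
  have hc : ContinuousAt c 0 := continuousAt_line _ _
  have h := hasDerivAt_symm_comp hb.zero_mem hD hc0 hc (hasDerivAt_line (L.proj θ) (D w))
  have hs0 : Ψ.symm (c 0) = 0 := by rw [hc0, Ψ.left_inv hb.zero_mem]
  have hi : ∀ i, HasDerivAt (fun s => Ψ.symm (c s) i) (w i) 0 := fun i =>
    hasDerivAt_pi.1 ((PiLp.hasFDerivAt_ofLp 2 (Ψ.symm (c 0))).comp_hasDerivAt (0 : ℝ) h) i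
  have hpos : ∀ i, w i ≠ 0 → ∀ᶠ s in 𝓝[>] (0 : ℝ), 0 < w i * Ψ.symm (c s) i := fun i hw =>
    (eventually_sign_of_hasDerivAt ((hi i).const_mul (w i)) (by simp [hs0])
      (mul_self_pos.2 hw)).1
  have htgt : ∀ᶠ s in 𝓝 (0 : ℝ), c s ∈ Ψ.target := by
    refine hc.eventually ?_
    rw [show c 0 = L.proj θ from line_zero _ _]
    exact hb.target_mem_nhds
  filter_upwards [hpos 0 h0, hpos 1 h1, htgt.filter_mono nhdsWithin_le_nhds] with s hs0 hs1 hs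
  have := hP (Ψ.symm (c s)) (by rw [← hb.source_eq]; exact Ψ.map_target hs) hs0 hs1
  rwa [Ψ.right_inv hs] at this

variable {G : Type*} [Group G]

/-! ### Region colourings near a crossing -/

/-- A region colouring near a crossing, in terms of its values on the four quadrants. -/
lemma IsBox.exists_quadrants_of_isColoringAt (hL : L.InGeneralPosition) {ρ : L.Arc → G} {f : S → G}
    {o u : Fin n × UnitAddCircle} {r : ℝ} {Ψ : OpenPartialHomeomorph Plane S}
    (ho : L.IsCrossing o u)
    (hb : L.IsBox o (fun t => {shift u (L.crossingSign o u * t)}) r Ψ)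
    (hf : ∀ q ∈ Ψ.target, L.IsColoringAt ρ f q) {a b c : L.Arc}
    (ha : ∀ s, |s| < r → L.OnArc (shift o s) a)
    (hb' : ∀ t, |t| < r → 0 < t → L.OnArc (shift u (L.crossingSign o u * t)) b)
    (hc : ∀ t, |t| < r → t < 0 → L.OnArc (shift u (L.crossingSign o u * t)) c) :
    ∃ A B C D : G, HasQuadrants r Ψ f A B C D ∧ B = A * ρ a ∧ D = C * ρ a ∧
      (if L.crossingSign o u = 1 then D = B * ρ b else B = D * ρ b) ∧
      (if L.crossingSign o u = 1 then C = A * ρ c else A = C * ρ c) := by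
  have hσ := crossingSign_eq_or hL ho.ne ho.1
  obtain ⟨A, B, C, D, hQ⟩ := hb.exists_quadrants (f := f) fun q hq => (hf q hq).1
  have hr := hb.pos
  have h2 : |r / 2| < r := by rw [abs_of_pos (half_pos hr)]; exact half_lt_self hr
  have h2' : |-(r / 2)| < r := by rwa [abs_neg]
  have htl : ∀ {s : ℝ}, |s| < r → !₂[s, 0] ∈ Ψ.source := hb.axis_left_mem
  have htr : ∀ {s : ℝ}, |s| < r → !₂[0, s] ∈ Ψ.source := hb.axis_right_mem
  refine ⟨A, B, C, D, hQ, ?_, ?_, ?_, ?_⟩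
  · exact (IsBox.hasJump_shift_pos_iff hQ hb h2 (half_pos hr)).1
      ((hf _ (Ψ.map_source (htl h2))).2 _ _ (hb.proj_shift h2)
        (hb.isSimplePoint_shift h2 fun h => absurd h (half_pos hr).ne') (ha _ h2))
  · exact (IsBox.hasJump_shift_neg_iff hQ hb h2' (neg_lt_zero.2 (half_pos hr))).1
      ((hf _ (Ψ.map_source (htl h2'))).2 _ _ (hb.proj_shift h2')
        (hb.isSimplePoint_shift h2' fun h => absurd h (neg_lt_zero.2 (half_pos hr)).ne) (ha _ h2'))
  · exact (IsBox.hasJump_under_pos_iff hQ hσ hb h2 (half_pos hr)).1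
      ((hf _ (Ψ.map_source (htr h2))).2 _ _ (hb.proj_shift_right h2)
        (hb.isSimplePoint_shift_right h2 (half_pos hr).ne') (hb' _ h2 (half_pos hr)))
  · exact (IsBox.hasJump_under_neg_iff hQ hσ hb h2' (neg_lt_zero.2 (half_pos hr))).1
      ((hf _ (Ψ.map_source (htr h2'))).2 _ _ (hb.proj_shift_right h2')
        (hb.isSimplePoint_shift_right h2' (neg_lt_zero.2 (half_pos hr)).ne)
        (hc _ h2' (neg_lt_zero.2 (half_pos hr))))

/-- The regions at a crossing are the quadrants of a box. -/
lemma IsBox.regionNext_quadrants (hL : L.InGeneralPosition) {R₀ : L.Region}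
    {o u : Fin n × UnitAddCircle} {r : ℝ} {Ψ : OpenPartialHomeomorph Plane S}
    (ho : L.IsCrossing o u)
    (hb : L.IsBox o (fun t => {shift u (L.crossingSign o u * t)}) r Ψ) {A B C D : L.Region}
    (hQ : HasQuadrants r Ψ (L.regionOf R₀) A B C D) :
    L.RegionNext (L.proj o) (L.velocity o - L.crossingSign o u • L.velocity u) A ∧
    L.RegionNext (L.proj o) (L.velocity o + L.crossingSign o u • L.velocity u) B ∧
    L.RegionNext (L.proj o) (-L.velocity o - L.crossingSign o u • L.velocity u) C ∧
    L.RegionNext (L.proj o) (-L.velocity o + L.crossingSign o u • L.velocity u) D := by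
  have hσσ : L.crossingSign o u * L.crossingSign o u = 1 := by
    rcases crossingSign_eq_or hL ho.ne ho.1 with h | h <;> simp [h]
  obtain ⟨E, -, hE⟩ := hb.oriented 0 hb.zero_mem
  have ho' := hb.velocity_eq hE
  have hu' : L.crossingSign o u • L.velocity u = E !₂[0, 1] := by
    rw [hb.velocity_right_eq hσσ hE, ← map_smul]
    congr 1; ext i; fin_cases i <;> simp [hσσ]
  have hin : ∀ z ∈ Metric.ball (0 : Plane) r, z 0 ≠ 0 → z 1 ≠ 0 →
      L.InRegion (Ψ z) (L.regionOf R₀ (Ψ z)) := fun z hz h0 h1 =>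
    inRegion_regionOf (by rw [hb.mem_graph_iff hz]; simp [h0, h1])
  have key : ∀ (w : Plane) (R : L.Region), w 0 ≠ 0 → w 1 ≠ 0 →
      (∀ z ∈ Metric.ball (0 : Plane) r, 0 < w 0 * z 0 → 0 < w 1 * z 1 →
        L.regionOf R₀ (Ψ z) = R) → L.RegionNext (L.proj o) (E w) R := by
    intro w R h0 h1 hR
    refine hb.eventually_line hE h0 h1 (P := fun q => L.InRegion q R) fun z hz hz0 hz1 => ?_
    rw [← hR z hz hz0 hz1]
    exact hin z hz (right_ne_zero_of_mul hz0.ne') (right_ne_zero_of_mul hz1.ne')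
  rw [hu', ho', ← map_neg, ← map_sub, ← map_add, ← map_sub, ← map_add]
  refine ⟨key _ _ ?_ ?_ ?_, key _ _ ?_ ?_ ?_, key _ _ ?_ ?_ ?_, key _ _ ?_ ?_ ?_⟩
  all_goals try simp
  · exact fun z hz h0 h1 => (hQ z (by simpa using hz)).1 h0 h1
  · exact fun z hz h0 h1 => (hQ z (by simpa using hz)).2.1 h0 h1
  · exact fun z hz h0 h1 => (hQ z (by simpa using hz)).2.2.1 h0 h1
  · exact fun z hz h0 h1 => (hQ z (by simpa using hz)).2.2.2 h0 h1

/-- The immersion condition provides at least one curve crossing the strand, so the jump condition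
is never vacuous. -/
lemma HasJump.unique (hL : L.InGeneralPosition) {f : S → G} {θ : Fin n × UnitAddCircle} {x y : G}
    (hx : L.HasJump f θ x) (hy : L.HasJump f θ y) : x = y := by
  set v := L.velocity θ with hv
  have hpos : 0 < cross v !₂[-v 1, v 0] := by
    have : v 0 ≠ 0 ∨ v 1 ≠ 0 := by
      by_contra! hcon
      exact hL.immersion θ (by ext i; fin_cases i <;> simp [← hv, hcon])
    simp only [cross, Matrix.cons_val_zero, Matrix.cons_val_one]
    rcases this with h | h <;> nlinarith [sq_nonneg (v 0), sq_nonneg (v 1), sq_pos_of_ne_zero h]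
  have hpos' : 0 < cross (L.velocity θ) (curveVelocity (line (L.proj θ) !₂[-v 1, v 0]) 0) := by
    rwa [curveVelocity_line]
  obtain ⟨h, h1, h2⟩ := hx _ 0 (line_zero _ _) (continuousAt_line _ _) hpos'
  obtain ⟨h', h1', h2'⟩ := hy _ 0 (line_zero _ _) (continuousAt_line _ _) hpos'
  obtain ⟨s, e1, e1'⟩ := (h1.and h1').exists
  obtain ⟨t, e2, e2'⟩ := (h2.and h2').exists
  obtain rfl := e1.symm.trans e1'
  exact mul_left_cancel (e2.symm.trans e2')

variable [T2Space S] [IsManifold (𝓡 2) ∞ S]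

/-- Two region colourings for the same arc colouring locally differ by a constant factor. -/
lemma exists_mul_eq_of_isColoringAt (hS : IsOrientedAtlas S) (hL : L.InGeneralPosition)
    {ρ : L.Arc → G} {f f' : S → G} {p : S} (hf : ∀ᶠ q in 𝓝 p, L.IsColoringAt ρ f q)
    (hf' : ∀ᶠ q in 𝓝 p, L.IsColoringAt ρ f' q) :
    ∃ g, ∀ᶠ y in 𝓝[L.underlyingGraphᶜ] p, f' y = g * f y := by
  by_cases hp : p ∈ L.underlyingGraph
  swap
  · refine ⟨f' p * (f p)⁻¹, ?_⟩
    filter_upwards [(hf.self_of_nhds.1 hp).filter_mono nhdsWithin_le_nhds,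
      (hf'.self_of_nhds.1 hp).filter_mono nhdsWithin_le_nhds] with y h1 h2
    rw [h1, h2, inv_mul_cancel_right]
  rcases exists_box_of_mem hS hL hp (hf.and hf') with
    ⟨θ, r, Ψ, hθ, rfl, hb, hs⟩ | ⟨o, u, r, Ψ, ho, rfl, hb, hs⟩
  · set a : L.Arc := ConnectedComponents.mk ⟨θ, hθ.not_isUnder⟩
    obtain ⟨hp, hm, hv⟩ := hb.exists_halves (f := f) fun q hq => (hs hq).1.1
    obtain ⟨hp', hm', hv'⟩ := hb.exists_halves (f := f') fun q hq => (hs hq).2.1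
    have h0 : |(0 : ℝ)| < r := by simpa using hb.pos
    have key : ∀ (f : S → G) (hp hm : G), (∀ z ∈ Metric.ball (0 : Plane) r,
        (0 < z 1 → f (Ψ z) = hp) ∧ (z 1 < 0 → f (Ψ z) = hm)) →
        L.IsColoringAt ρ f (L.proj θ) → hp = hm * ρ a := by
      intro f hp hm hv hf
      have hev := IsBox.eventually_mem_ball (hb.axis_left_mem h0) hb
      refine (hb.hasJump_shift_iff h0 (hev.mono fun y hy => (hv y hy).1)
        (hev.mono fun y hy => (hv y hy).2)).1 (hf.2 _ a (by rw [shift_zero])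
          (by rwa [shift_zero]) ⟨by rw [shift_zero]; exact hθ.not_isUnder, by simp [a, shift_zero]⟩)
    have hcol := hs (mem_of_mem_nhds hb.target_mem_nhds)
    have hj := key f hp hm hv hcol.1
    have hj' := key f' hp' hm' hv' hcol.2
    refine ⟨hm' * hm⁻¹, ?_⟩
    filter_upwards [self_mem_nhdsWithin, nhdsWithin_le_nhds hb.target_mem_nhds] with y hyg hy
    obtain ⟨z, hz, rfl⟩ := hb.exists_eq hy
    rw [mem_compl_iff, hb.mem_graph_iff hz] at hyg
    push Not at hyg
    rcases lt_or_gt_of_ne hyg.1 with h | h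
    · rw [(hv z hz).2 h, (hv' z hz).2 h, inv_mul_cancel_right]
    · rw [(hv z hz).1 h, (hv' z hz).1 h, hj, hj']; group
  · obtain ⟨a, b, c, ha, hb', hc⟩ := hb.exists_arcs hL ho
    obtain ⟨A, B, C, D, hQ, h1, h2, h3, h4⟩ := hb.exists_quadrants_of_isColoringAt hL ho
      (fun q hq => (hs hq).1) ha hb' hc
    obtain ⟨A', B', C', D', hQ', h1', h2', h3', h4'⟩ := hb.exists_quadrants_of_isColoringAt hL ho
      (fun q hq => (hs hq).2) ha hb' hc
    -- The jumps across `a` (twice) and `c` determine the other three quadrants from the first, so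
    -- the factor found on `A` works on all of them.
    have hB : B' = A' * A⁻¹ * B := by rw [h1, h1']; group
    have hC : C' = A' * A⁻¹ * C := by
      split_ifs at h4 h4' with hσ
      · rw [h4, h4']; group
      · rw [h4, h4']; group
    have hD : D' = A' * A⁻¹ * D := by rw [h2, h2', hC]; group
    refine ⟨A' * A⁻¹, ?_⟩
    filter_upwards [self_mem_nhdsWithin, nhdsWithin_le_nhds hb.target_mem_nhds] with y hyg hy
    obtain ⟨z, hz, rfl⟩ := hb.exists_eq hy
    rw [mem_compl_iff, hb.mem_graph_iff hz] at hyg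
    simp only [singleton_nonempty, and_true, not_or] at hyg
    rcases lt_or_gt_of_ne hyg.2 with h0 | h0 <;> rcases lt_or_gt_of_ne hyg.1 with h1 | h1
    · rw [(hQ z hz).2.2.1 h0 h1, (hQ' z hz).2.2.1 h0 h1, hC]
    · rw [(hQ z hz).2.2.2 h0 h1, (hQ' z hz).2.2.2 h0 h1, hD]
    · rw [(hQ z hz).1 h0 h1, (hQ' z hz).1 h0 h1, inv_mul_cancel_right]
    · rw [(hQ z hz).2.1 h0 h1, (hQ' z hz).2.1 h0 h1, hB]

/-- The arc colouring of a region colouring satisfies the Wirtinger relations. -/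
lemma isArcColoring_of_isColoringAt (hS : IsOrientedAtlas S) (hL : L.InGeneralPosition)
    {ρ : L.Arc → G} {f : S → G} (hf : ∀ p, L.IsColoringAt ρ f p) : L.IsArcColoring ρ := by
  intro o u a b c ho ha hb hc
  obtain ⟨r, Ψ, hbox, -⟩ := exists_crossingBox hS hL ho.ne ho.1 univ_mem
  obtain ⟨a', b', c', ha', hb', hc'⟩ := hbox.exists_arcs hL ho
  have haa : a = a' := ha.unique (by simpa [shift_zero] using ha' 0 (by simpa using hbox.pos))
  have hbb : b = b' := by
    obtain ⟨ε, h1, h2, h3⟩ := (hb.and (eventually_pos_abs_lt hbox.pos)).exists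
    exact h1.unique (hb' ε h3 h2)
  have hcc : c = c' := by
    obtain ⟨ε, h1, h2, h3⟩ := (hc.and (eventually_pos_abs_lt hbox.pos)).exists
    exact h1.unique (by simpa using hc' (-ε) (by simpa using h3) (by linarith))
  subst haa hbb hcc
  obtain ⟨A, B, C, D, -, h1, h2, h3, h4⟩ := hbox.exists_quadrants_of_isColoringAt hL ho
      (fun q _ => hf q) ha' hb' hc'
  -- Going around the crossing in two ways between opposite quadrants yields `ρ a * ρ b` and `ρ c *
  -- ρ a`: from `A` to `D` if `σ = 1`, from `C` to `B` otherwise.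
  split_ifs at h3 h4 with hσ
  · rw [h2, h4, h1, mul_assoc, mul_assoc] at h3
    exact (mul_left_cancel h3).symm
  · rw [h1, h2, h4, mul_assoc, mul_assoc] at h3
    exact (mul_left_cancel h3).symm

/-! ### Solutions of the Dehn relations and their arc colourings. -/

variable (L) in
/-- The function `x` on the regions satisfies the relations of the Dehn group. -/
def IsRegionColoring (x : L.Region → G) : Prop :=
  ∀ o u A B C D, L.IsCrossing o u →
    L.RegionNext (L.proj o) (L.velocity o - L.crossingSign o u • L.velocity u) A →
    L.RegionNext (L.proj o) (L.velocity o + L.crossingSign o u • L.velocity u) B →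
    L.RegionNext (L.proj o) (-L.velocity o - L.crossingSign o u • L.velocity u) C →
    L.RegionNext (L.proj o) (-L.velocity o + L.crossingSign o u • L.velocity u) D →
    (x A)⁻¹ * x B = (x C)⁻¹ * x D

/-- Both sides of the Dehn relation are the jump across the overcrossing arc, which is one and the
same arc before and after the crossing. -/
lemma isRegionColoring_of_isColoringAt (hS : IsOrientedAtlas S) (hL : L.InGeneralPosition)
    {ρ : L.Arc → G} {R₀ : L.Region} {x : L.Region → G}
    (hx : ∀ p, L.IsColoringAt ρ (fun q => x (L.regionOf R₀ q)) p) : L.IsRegionColoring x := by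
  intro o u A B C D ho hA hB hC hD
  obtain ⟨r, Ψ, hb, -⟩ := exists_crossingBox hS hL ho.ne ho.1 univ_mem
  obtain ⟨A', B', C', D', hQ⟩ := hb.exists_quadrants (f := L.regionOf R₀)
    fun q _ hq => eventually_regionOf_eq hq
  obtain ⟨hA', hB', hC', hD'⟩ := hb.regionNext_quadrants hL ho hQ
  obtain rfl := hA.unique hA'
  obtain rfl := hB.unique hB'
  obtain rfl := hC.unique hC'
  obtain rfl := hD.unique hD'
  obtain ⟨a, b, c, ha, hb', hc⟩ := hb.exists_arcs hL ho
  have hr := hb.pos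
  have h2 : |r / 2| < r := by rw [abs_of_pos (half_pos hr)]; exact half_lt_self hr
  have h2' : |-(r / 2)| < r := by rwa [abs_neg]
  have hQx := hQ.comp x
  have e1 := (IsBox.hasJump_shift_pos_iff hQx hb h2 (half_pos hr)).1
      ((hx _).2 _ _ rfl
        (hb.isSimplePoint_shift h2 fun h => absurd h (half_pos hr).ne') (ha _ h2))
  have e2 := (IsBox.hasJump_shift_neg_iff hQx hb h2' (neg_lt_zero.2 (half_pos hr))).1
      ((hx _).2 _ _ rfl
        (hb.isSimplePoint_shift h2' fun h => absurd h (neg_lt_zero.2 (half_pos hr)).ne) (ha _ h2'))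
  rw [e1, e2]; group

/-- Jumps are prescribed only at simple points; this supplies such points arbitrarily close to any
point of an arc, including overcrossings. -/
lemma eventually_isSimplePoint_shift (hS : IsOrientedAtlas S) (hL : L.InGeneralPosition)
    {θ : Fin n × UnitAddCircle} (hθ : ¬ L.IsUnder θ) :
    ∀ᶠ ε : ℝ in 𝓝[>] 0, L.IsSimplePoint (shift θ ε) := by
  by_cases hs : L.IsSimplePoint θ
  · obtain ⟨r, Ψ, hb, -⟩ := exists_simpleBox hS hL hs univ_mem
    filter_upwards [eventually_pos_abs_lt hb.pos] with ε hε
    exact hb.isSimplePoint_shift hε.2 fun _ => rfl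
  · obtain ⟨u, hu⟩ := exists_isCrossing_of_not_isSimplePoint hs hθ
    obtain ⟨r, Ψ, hb, -⟩ := exists_crossingBox hS hL hu.ne hu.1 univ_mem
    filter_upwards [eventually_pos_abs_lt hb.pos] with ε hε
    exact hb.isSimplePoint_shift hε.2 fun h => absurd h hε.1.ne'

lemma tendsto_shift (θ : Fin n × UnitAddCircle) : Tendsto (shift θ) (𝓝[>] 0) (𝓝 θ) := by
  have := (continuous_shift θ).tendsto 0
  rw [shift_zero] at this
  exact this.mono_left nhdsWithin_le_nhds

/-- The jump of a region colouring is locally constant along the arcs. -/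
lemma IsRegionColoring.eventually_hasJump (hS : IsOrientedAtlas S) (hL : L.InGeneralPosition)
    {x : L.Region → G} (hx : L.IsRegionColoring x) (R₀ : L.Region) {θ : Fin n × UnitAddCircle}
    (hθ : ¬ L.IsUnder θ) : ∃ y, ∀ᶠ θ' in 𝓝 θ, L.IsSimplePoint θ' →
      L.HasJump (fun q => x (L.regionOf R₀ q)) θ' y := by
  by_cases hs : L.IsSimplePoint θ
  · obtain ⟨r, Ψ, hb, -⟩ := exists_simpleBox hS hL hs univ_mem
    obtain ⟨hp, hm, hv⟩ := hb.exists_halves (f := fun q => x (L.regionOf R₀ q))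
      fun q _ hq => (eventually_regionOf_eq hq).mono fun _ h => congrArg x h
    refine ⟨hm⁻¹ * hp, ?_⟩
    filter_upwards [image_shift_mem_nhds θ hb.pos]
    rintro _ ⟨s, hs, rfl⟩ -
    have hs' : |s| < r := by simpa using hs
    have hev := IsBox.eventually_mem_ball (hb.axis_left_mem hs') hb
    exact (hb.hasJump_shift_iff hs' (hev.mono fun y hy => (hv y hy).1)
        (hev.mono fun y hy => (hv y hy).2)).2 (mul_inv_cancel_left _ _).symm
  · obtain ⟨u, hu⟩ := exists_isCrossing_of_not_isSimplePoint hs hθ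
    obtain ⟨r, Ψ, hb, -⟩ := exists_crossingBox hS hL hu.ne hu.1 univ_mem
    obtain ⟨A, B, C, D, hQ⟩ := hb.exists_quadrants (f := L.regionOf R₀)
      fun q _ hq => eventually_regionOf_eq hq
    obtain ⟨hA, hB, hC, hD⟩ := hb.regionNext_quadrants hL hu hQ
    -- The Dehn relation makes the jump after the overcrossing agree with the one before it.
    have hrel := hx θ u A B C D hu hA hB hC hD
    refine ⟨(x A)⁻¹ * x B, ?_⟩
    filter_upwards [image_shift_mem_nhds θ hb.pos]
    rintro _ ⟨s, hs', rfl⟩ hsimp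
    have hs' : |s| < r := by simpa using hs'
    rcases lt_trichotomy s 0 with h | rfl | h
    · exact (IsBox.hasJump_shift_neg_iff (hQ.comp x) hb hs' h).2
        (by rw [hrel, mul_inv_cancel_left])
    · rw [shift_zero] at hsimp
      exact absurd hsimp hs
    · exact (IsBox.hasJump_shift_pos_iff (hQ.comp x) hb hs' h).2 (mul_inv_cancel_left _ _).symm

/-- A solution of the Dehn relations has an associated arc colouring. -/
lemma IsRegionColoring.exists_arc_coloring (hS : IsOrientedAtlas S) (hL : L.InGeneralPosition)
    {x : L.Region → G} (hx : L.IsRegionColoring x) (R₀ : L.Region) :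
    ∃ ρ : L.Arc → G, ∀ p, L.IsColoringAt ρ (fun q => x (L.regionOf R₀ q)) p := by
  choose y hy using fun θ : {θ // ¬ L.IsUnder θ} => hx.eventually_hasJump hS hL R₀ θ.2
  let _ : TopologicalSpace G := ⊥
  have : DiscreteTopology G := ⟨rfl⟩
  -- With `G` discrete, continuity means local constancy, so `y` factors through the connected
  -- components, which are the arcs. Nearby choices agree since both are the jump at a common simple
  -- point.
  have hc : Continuous y := by
    rw [continuous_iff_continuousAt]
    intro θ
    rw [ContinuousAt, nhds_discrete G, tendsto_pure]
    have h := continuous_subtype_val.continuousAt.eventually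
      (eventually_eventually_nhds.2 (hy θ))
    filter_upwards [h] with θ' hθ'
    obtain ⟨ε, h1, h2, h3⟩ := (((tendsto_shift θ'.1).eventually hθ').and
      (((tendsto_shift θ'.1).eventually (hy θ')).and
        (eventually_isSimplePoint_shift hS hL θ'.2))).exists
    exact (h2 h3).unique hL (h1 h3)
  refine ⟨hc.connectedComponentsLift, fun p => ⟨fun hp =>
    (eventually_regionOf_eq hp).mono fun _ h => congrArg x h, ?_⟩⟩
  rintro θ _ - hs ⟨h, rfl⟩
  rw [hc.connectedComponentsLift_apply_coe]
  exact (hy ⟨θ, h⟩).self_of_nhds hs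

end OrientedLink

end ThickenedSurface

namespace ThickenedSurface

/-! ### Integration along curves -/

section Jumps

variable {G : Type*} [Group G]

lemma eq_of_locally_constant {X : Type*} {F : ℝ → X} {a b : ℝ} (hab : a ≤ b)
    (hF : ∀ t ∈ Icc a b, ∀ᶠ s in 𝓝[Icc a b] t, F s = F t) : F a = F b := by
  let _ : TopologicalSpace X := ⊥
  have : DiscreteTopology X := ⟨rfl⟩
  refine isPreconnected_Icc.constant (f := F) (fun t ht => ?_) (left_mem_Icc.2 hab)
    (right_mem_Icc.2 hab)
  rw [ContinuousWithinAt, nhds_discrete X, tendsto_pure]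
  exact hF t ht

/-- A piecewise constant function on an interval changes by the product of its jumps. -/
lemma eq_mul_prod_of_jumps {F : ℝ → G} {b : ℝ} (l : List (ℝ × G)) :
    ∀ a, a ≤ b → (l.map Prod.fst).Pairwise (· < ·) → (∀ x ∈ l, x.1 ∈ Ioo a b) →
    (∀ t ∈ Icc a b, t ∉ l.map Prod.fst → ∀ᶠ s in 𝓝[Icc a b] t, F s = F t) →
    (∀ x ∈ l, ∃ h, (∀ᶠ s in 𝓝[<] x.1, F s = h) ∧ ∀ᶠ s in 𝓝[>] x.1, F s = h * x.2) →
    F b = F a * (l.map Prod.snd).prod := by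
  induction l with
  | nil =>
    intro a hab _ _ hF _
    simpa using (eq_of_locally_constant hab fun t ht => hF t ht (by simp)).symm
  | cons x l ih =>
    intro a hab hl hI hF hJ
    obtain ⟨t, g⟩ := x
    rw [List.map_cons, List.pairwise_cons] at hl
    obtain ⟨h, h1, h2⟩ := hJ (t, g) List.mem_cons_self
    have ht : t ∈ Ioo a b := hI (t, g) List.mem_cons_self
    -- The values just before and just after the first jump are sampled at `m'` and `m`; `m` also
    -- precedes the remaining jumps, so the induction restarts there.
    obtain ⟨m', hm', hm'I⟩ := (h1.and (Ioo_mem_nhdsLT ht.1)).exists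
    have hlt : ∀ᶠ s in 𝓝[>] t, ∀ x ∈ l, s < x.1 := by
      have hfin : {x | x ∈ l}.Finite := List.finite_toSet l
      refine (eventually_all_finite hfin).2 fun x hx => ?_
      exact nhdsWithin_le_nhds (gt_mem_nhds (hl.1 _ (List.mem_map_of_mem hx)))
    obtain ⟨m, ⟨hm, hml⟩, hmI⟩ := ((h2.and hlt).and (Ioo_mem_nhdsGT ht.2)).exists
    have e1 : F a = F m' := by
      refine eq_of_locally_constant hm'I.1.le fun s hs => ?_
      refine (hF s ⟨hs.1, hs.2.trans (hm'I.2.trans ht.2).le⟩ ?_).filter_mono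
        (nhdsWithin_mono _ (Icc_subset_Icc le_rfl (hm'I.2.trans ht.2).le))
      rw [List.map_cons, List.mem_cons, not_or]
      have hst : s < t := hs.2.trans_lt hm'I.2
      exact ⟨hst.ne, fun hcon => lt_asymm hst (hl.1 s hcon)⟩
    have e2 := ih m hmI.2.le hl.2
      (fun x hx => ⟨hml x hx, (hI x (List.mem_cons_of_mem _ hx)).2⟩) ?_
      (fun x hx => hJ x (List.mem_cons_of_mem _ hx))
    · rw [e2, hm, e1, hm', List.map_cons, List.prod_cons, mul_assoc]
    · intro s hs hsl
      have hts : t < s := hmI.1.trans_le hs.1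
      refine (hF s ⟨(ht.1.trans hts).le, hs.2⟩ ?_).filter_mono
        (nhdsWithin_mono _ (Icc_subset_Icc (ht.1.trans hmI.1).le le_rfl))
      rw [List.map_cons, List.mem_cons, not_or]
      exact ⟨hts.ne', hsl⟩

end Jumps

namespace OrientedLink

universe u v

variable {S : Type u} [TopologicalSpace S] {n : ℕ} {L : OrientedLink S n}
  [ChartedSpace Plane S] {G : Type v} [Group G]

/-- The integral of the diagram along a curve is the ratio of the values of region colourings. -/
lemma IsIntegral.eq_mul {ρ : L.Arc → G} (φ : L.WirtingerGroup →* G)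
    (hφ : ∀ a, φ (PresentedGroup.of a) = ρ a) {c : ℝ → S} (hc : Continuous c)
    (hgp : L.CurveInGeneralPosition c) {w : L.WirtingerGroup} (hw : L.IsIntegral c w) {F : ℝ → G}
    (hF : ∀ t ∈ Icc (0 : ℝ) 1, c t ∉ L.underlyingGraph → ∀ᶠ s in 𝓝[Icc 0 1] t, F s = F t)
    (hJ : ∀ t ∈ Ioo (0 : ℝ) 1, c t ∈ L.underlyingGraph → ∃ f, L.IsColoringAt ρ f (c t) ∧
      ∀ᶠ s in 𝓝[≠] t, F s = f (c s)) : F 1 = F 0 * φ w := by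
  obtain ⟨l, hl, hmem, hx, rfl⟩ := hw
  set l' : List (ℝ × G) := l.map fun x => (x.1, ρ x.2.2 ^
      (SignType.sign (cross (L.velocity x.2.1) (curveVelocity c x.1)) : ℤ)) with hl'
  have hfst : l'.map Prod.fst = l.map Prod.fst := by simp [hl', Function.comp_def]
  have hsnd : φ (l.map fun x => (PresentedGroup.of x.2.2 : L.WirtingerGroup) ^
      (SignType.sign (cross (L.velocity x.2.1) (curveVelocity c x.1)) : ℤ)).prod
      = (l'.map Prod.snd).prod := by
    rw [map_list_prod]
    simp [hl', Function.comp_def, hφ]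
  have hIoo : ∀ t ∈ l.map Prod.fst, t ∈ Ioo (0 : ℝ) 1 ∧ c t ∈ L.underlyingGraph := by
    intro t ht
    obtain ⟨⟨h0, h1⟩, h2⟩ := (hmem t).1 ht
    refine ⟨⟨lt_of_le_of_ne h0 ?_, lt_of_le_of_ne h1 ?_⟩, h2⟩
    · rintro rfl; exact hgp.start_notMem h2
    · rintro rfl; exact hgp.end_notMem h2
  rw [hsnd]
  refine eq_mul_prod_of_jumps l' 0 zero_le_one (by rwa [hfst]) ?_ ?_ ?_
  · intro x hx
    exact (hIoo x.1 (by rw [← hfst]; exact List.mem_map_of_mem hx)).1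
  · intro t ht hnot
    rw [hfst, hmem] at hnot
    exact hF t ht fun h => hnot ⟨ht, h⟩
  · intro y hy
    obtain ⟨⟨t, θ, a⟩, hxl, rfl⟩ := List.mem_map.1 hy
    obtain ⟨hp, ha⟩ := hx _ hxl
    obtain ⟨ht, htg⟩ := hIoo t (List.mem_map_of_mem (f := Prod.fst) hxl)
    obtain ⟨hsimp, hne⟩ := hgp.transverse t ht θ hp
    obtain ⟨f, hf, hFf⟩ := hJ t ht htg
    have hjump := hf.2 θ a hp hsimp ha
    have hlt := hFf.filter_mono (nhdsWithin_mono t (s := Iio t) fun s hs => ne_of_lt hs)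
    have hgt := hFf.filter_mono (nhdsWithin_mono t (s := Ioi t) fun s hs => ne_of_gt hs)
    rcases lt_or_gt_of_ne hne with h | h
    · obtain ⟨k, h1, h2⟩ := hjump.of_neg hp.symm hc.continuousAt h
      refine ⟨k, ?_, ?_⟩
      · filter_upwards [h1, hlt] with s e1 e2 using e2.trans e1
      · filter_upwards [h2, hgt] with s e1 e2
        rw [e2, e1]; simp [sign_neg h]
    · obtain ⟨k, h1, h2⟩ := hjump c t hp.symm hc.continuousAt h
      refine ⟨k, ?_, ?_⟩
      · filter_upwards [h1, hlt] with s e1 e2 using e2.trans e1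
      · filter_upwards [h2, hgt] with s e1 e2
        rw [e2, e1]; simp [sign_pos h]

lemma CurveInGeneralPosition.exists_isIntegral {c : ℝ → S} (hgp : L.CurveInGeneralPosition c) :
    ∃ w, L.IsIntegral c w := by
  have hex : ∀ t : {t : ℝ | t ∈ Icc (0 : ℝ) 1 ∧ c t ∈ L.underlyingGraph},
      ∃ (θ : Fin n × UnitAddCircle) (a : L.Arc), L.proj θ = c t ∧ L.OnArc θ a := by
    rintro ⟨t, ⟨h0, h1⟩, θ, hθ⟩
    have ht : t ∈ Ioo (0 : ℝ) 1 := by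
      refine ⟨lt_of_le_of_ne h0 ?_, lt_of_le_of_ne h1 ?_⟩
      · rintro rfl; exact hgp.start_notMem ⟨θ, hθ⟩
      · rintro rfl; exact hgp.end_notMem ⟨θ, hθ⟩
    exact ⟨θ, _, hθ, (hgp.transverse t ht θ hθ).1.not_isUnder, rfl⟩
  choose Θ A hΘ hA using hex
  set m := hgp.finite_times.toFinset.sort (· ≤ ·) with hm
  have hmem : ∀ t, t ∈ m ↔ t ∈ Icc (0 : ℝ) 1 ∧ c t ∈ L.underlyingGraph := by
    intro t; rw [hm, Finset.mem_sort, Set.Finite.mem_toFinset]; rfl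
  set l : List (ℝ × (Fin n × UnitAddCircle) × L.Arc) :=
    m.attach.map fun t => (t.1, Θ ⟨t.1, (hmem t.1).1 t.2⟩, A ⟨t.1, (hmem t.1).1 t.2⟩) with hl
  have hfst : l.map Prod.fst = m := by simp [hl, Function.comp_def]
  refine ⟨_, l, ?_, ?_, ?_, rfl⟩
  · rw [hfst]; exact (Finset.sortedLT_sort _).pairwise
  · intro t; rw [hfst]; exact hmem t
  · intro x hx
    obtain ⟨t, -, rfl⟩ := List.mem_map.1 hx
    exact ⟨hΘ _, hA _⟩

/-! ### The covering of local region colourings -/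

lemma IsColoringAt.mul_left {ρ : L.Arc → G} {f : S → G} {p : S} (h : L.IsColoringAt ρ f p)
    (g : G) : L.IsColoringAt ρ (fun q => g * f q) p := by
  refine ⟨fun hp => (h.1 hp).mono fun y hy => congrArg (g * ·) hy, fun θ a h1 h2 h3 => ?_⟩
  intro c t hct hc hpos
  obtain ⟨k, e1, e2⟩ := h.2 θ a h1 h2 h3 c t hct hc hpos
  exact ⟨g * k, e1.mono fun s hs => congrArg (g * ·) hs,
    e2.mono fun s hs => (congrArg (g * ·) hs).trans (mul_assoc _ _ _).symm⟩

variable [T2Space S] [IsManifold (𝓡 2) ∞ S]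

/-- The germs of region colourings for a given arc colouring form a covering space of the
surface. -/
lemma exists_covering_of_isArcColoring (hS : IsOrientedAtlas S) (hL : L.InGeneralPosition)
    {ρ : L.Arc → G} (hρ : L.IsArcColoring ρ) :
    ∃ (E : Type (max u v)) (_ : TopologicalSpace E) (π : E → S) (val : E → G), IsCoveringMap π ∧
      Function.Surjective π ∧
      (∀ e₀, ∃ f, (∀ᶠ q in 𝓝 (π e₀), L.IsColoringAt ρ f q) ∧
        ∀ᶠ e in 𝓝 e₀, π e ∉ L.underlyingGraph → val e = f (π e)) ∧
      ∀ e e', π e = π e' → π e ∉ L.underlyingGraph → val e = val e' → e = e' := by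
  classical
  let _ : TopologicalSpace G := ⊥
  have : DiscreteTopology G := ⟨rfl⟩
  choose f hf using fun p => exists_isColoringAt hS hL hρ p
  choose U hUf hUo hUm using fun p => eventually_nhds_iff.1 (hf p)
  have hne : ∀ p, (𝓝[L.underlyingGraphᶜ] p).NeBot := dense_compl_underlyingGraph hS hL
  have hex : ∀ i j x, x ∈ U i ∩ U j →
      ∃ g, ∀ᶠ y in 𝓝[L.underlyingGraphᶜ] x, f i y = g * f j y := fun i j x hx =>
    exists_mul_eq_of_isColoringAt hS hL
      (mem_of_superset ((hUo j).mem_nhds hx.2) fun y hy => hUf j y hy)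
      (mem_of_superset ((hUo i).mem_nhds hx.1) fun y hy => hUf i y hy)
  -- The transition factor between two local colourings; the value `1` is a default where no factor
  -- exists, which does not happen over `U i ∩ U j`.
  let γ : S → S → S → G := fun i j x =>
    if h : ∃ g, ∀ᶠ y in 𝓝[L.underlyingGraphᶜ] x, f i y = g * f j y then h.choose else 1
  have hγ : ∀ i j x, x ∈ U i ∩ U j →
      ∀ᶠ y in 𝓝[L.underlyingGraphᶜ] x, f i y = γ i j x * f j y := by
    intro i j x hx
    have h := hex i j x hx
    simp only [γ, dif_pos h]
    exact h.choose_spec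
  have huniq : ∀ i j x g, x ∈ U i ∩ U j →
      (∀ᶠ y in 𝓝[L.underlyingGraphᶜ] x, f i y = g * f j y) → γ i j x = g := by
    intro i j x g hx hg
    obtain ⟨y, h1, h2⟩ := ((hγ i j x hx).and hg).exists
    exact mul_right_cancel (h1.symm.trans h2)
  have hγloc : ∀ i j x, x ∈ U i ∩ U j → ∀ᶠ x' in 𝓝 x, γ i j x' = γ i j x := by
    intro i j x hx
    have h1 := eventually_eventually_nhds.2 (eventually_nhdsWithin_iff.1 (hγ i j x hx))
    filter_upwards [h1, ((hUo i).inter (hUo j)).mem_nhds hx] with x' h2 hx'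
    exact huniq i j x' _ hx' (eventually_nhdsWithin_iff.2 h2)
  let Z : FiberBundleCore S S G :=
    { baseSet := U
      isOpen_baseSet := hUo
      indexAt := id
      mem_baseSet_at := hUm
      -- The coordinate `v` in chart `i` stands for the germ of `v * f i`, which equals `v * γ i j x
      -- * f j` off the graph.
      coordChange := fun i j x v => v * γ i j x
      coordChange_self := by
        intro i x hx v
        rw [huniq i i x 1 ⟨hx, hx⟩ (by simp), mul_one]
      continuousOn_coordChange := by
        rintro i j ⟨x, v⟩ ⟨hx, -⟩
        rw [ContinuousWithinAt, nhds_discrete G, tendsto_pure]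
        have hloc := hγloc i j x hx
        have hfst : Tendsto Prod.fst (𝓝[(U i ∩ U j) ×ˢ univ] (x, v)) (𝓝 x) :=
          (continuous_fst.tendsto (x, v)).mono_left nhdsWithin_le_nhds
        have hsnd : ∀ᶠ p in 𝓝[(U i ∩ U j) ×ˢ univ] (x, v), p.2 = v := by
          have := (continuous_snd.tendsto (x, v)).mono_left
            (nhdsWithin_le_nhds (s := (U i ∩ U j) ×ˢ univ))
          rwa [nhds_discrete G, tendsto_pure] at this
        filter_upwards [hfst.eventually hloc, hsnd] with p h1 h2
        rw [h1, h2]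
      coordChange_comp := by
        intro i j k x hx v
        rw [mul_assoc]
        congr 1
        refine (huniq i k x _ ⟨hx.1.1, hx.2⟩ ?_).symm
        filter_upwards [hγ i j x hx.1, hγ j k x ⟨hx.1.2, hx.2⟩] with y h1 h2
        rw [h1, h2, mul_assoc] }
  have hval : ∀ i x, x ∈ U i → x ∉ L.underlyingGraph → f x x = γ x i x * f i x := fun i x hx hxg =>
    (hγ x i x ⟨hUm x, hx⟩).self_of_nhdsWithin hxg
  let co : Z.TotalSpace → G := fun e => e.2
  -- The chart chosen at `x` has index `x`, so a point `(x, v)` is the germ of `v * f x`, and the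
  -- last function evaluates it at `x`. Only its values off the graph matter.
  refine ⟨Z.TotalSpace, inferInstance, Z.proj, fun e => co e * f e.1 e.1,
    FiberBundle.isCoveringMap (F := G) (E := Z.Fiber), fun x => ⟨⟨x, (1 : G)⟩, rfl⟩, ?_, ?_⟩
  · intro e₀
    refine ⟨fun q => co e₀ * f e₀.1 q, ?_, ?_⟩
    · filter_upwards [(hUo e₀.1).mem_nhds (hUm e₀.1)] with q hq
      exact (hUf e₀.1 q hq).mul_left _
    · have hcont : ContinuousAt (fun e => (Z.localTrivAt e₀.1 e).2) e₀ :=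
        continuous_snd.continuousAt.comp
          ((Z.localTrivAt e₀.1).continuousAt (Z.mk_mem_localTrivAt_source e₀.1 e₀.2))
      rw [ContinuousAt, nhds_discrete G, tendsto_pure] at hcont
      have hU : ∀ᶠ e in 𝓝 e₀, Z.proj e ∈ U e₀.1 :=
        Z.continuous_proj.continuousAt.eventually ((hUo e₀.1).mem_nhds (hUm e₀.1))
      filter_upwards [hcont, hU] with e he heU heg
      have h1 : co e * γ e.1 e₀.1 e.1 = co e₀ := by
        have h2 : (Z.localTrivAt e₀.1 e₀).2 = co e₀ := by rw [Z.localTrivAt_apply]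
        exact he.trans h2
      change co e * f e.1 e.1 = co e₀ * f e₀.1 e.1
      rw [hval e₀.1 e.1 heU heg, ← h1, mul_assoc]
  · rintro ⟨x, v⟩ ⟨x', v'⟩ hπ hg hv
    obtain rfl : x = x' := hπ
    obtain rfl : v = v' := mul_right_cancel (G := G) hv
    rfl

end OrientedLink

end ThickenedSurface

namespace ThickenedSurface

/-! ### The polygon -/

lemma continuous_sidePoint (g k : ℕ) : Continuous (sidePoint g k) := by
  unfold sidePoint
  refine Continuous.subtype_mk ?_ _
  exact continuous_subtype_val.comp (Circle.exp.continuous.comp (by fun_prop))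

lemma sidePoint_one (g k : ℕ) : sidePoint g k 1 = sidePoint g (k + 1) 0 := by
  unfold sidePoint
  congr 3
  push_cast
  ring

namespace PolygonModel

variable {S : Type*} [TopologicalSpace S] {g : ℕ} (P : PolygonModel S g)

lemma glue_x {j : ℕ} (hj : j < g) {t : ℝ} (ht : t ∈ Icc (0 : ℝ) 1) :
    P.toFun (sidePoint g (4 * j) t) = P.toFun (sidePoint g (4 * j + 2) (1 - t)) :=
  (P.eq_iff _ _).2 (.rel _ _ (.x j hj t ht))

lemma glue_y {j : ℕ} (hj : j < g) {t : ℝ} (ht : t ∈ Icc (0 : ℝ) 1) :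
    P.toFun (sidePoint g (4 * j + 1) t) = P.toFun (sidePoint g (4 * j + 3) (1 - t)) :=
  (P.eq_iff _ _).2 (.rel _ _ (.y j hj t ht))

lemma continuous_xLoop (j : Fin g) : Continuous (P.xLoop j) :=
  P.continuous_toFun.comp (continuous_sidePoint _ _)

lemma continuous_yLoop (j : Fin g) : Continuous (P.yLoop j) :=
  P.continuous_toFun.comp (continuous_sidePoint _ _)

lemma yLoop_closed (j : Fin g) : P.yLoop j 1 = P.yLoop j 0 := by
  have hx1 := P.glue_x j.2 (t := 1) (by simp)
  have hx0 := P.glue_x j.2 (t := 0) (by simp)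
  have hy1 := P.glue_y j.2 (t := 1) (by simp)
  simp only [sub_self, sub_zero, sidePoint_one] at hx0 hx1 hy1
  simp only [yLoop, sidePoint_one]
  exact hx1.symm

/-- The end points are identified through a chain of vertices of the commutator block, using the
gluing of the `y`-sides as well as that of the `x`-sides. -/
lemma xLoop_closed (j : Fin g) : P.xLoop j 1 = P.xLoop j 0 := by
  have hx1 := P.glue_x j.2 (t := 1) (by simp)
  have hx0 := P.glue_x j.2 (t := 0) (by simp)
  have hy1 := P.glue_y j.2 (t := 1) (by simp)
  simp only [sub_self, sub_zero, sidePoint_one] at hx0 hx1 hy1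
  simp only [xLoop, sidePoint_one]
  exact hx1.trans (hy1.trans hx0.symm)

/-- Maps on the surface are maps on the disc compatible with the identifications. -/
lemma exists_factor [T2Space S] {E : Type*} [TopologicalSpace E] {σ : Disc → E}
    (hσ : Continuous σ) (hglue : ∀ z w, SideGlue g z w → σ z = σ w) :
    ∃ s : S → E, Continuous s ∧ ∀ z, s (P.toFun z) = σ z := by
  have h : ∀ z w, P.toFun z = P.toFun w → σ z = σ w := by
    intro z w hzw
    induction (P.eq_iff z w).1 hzw with
    | rel z w h => exact hglue z w h
    | refl z => rfl
    | symm z w h ih => exact (ih ((P.eq_iff z w).2 h)).symm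
    | trans x y z h1 h2 ih1 ih2 =>
      exact (ih1 ((P.eq_iff _ _).2 h1)).trans (ih2 ((P.eq_iff _ _).2 h2))
  have hs : ∀ z, σ (Function.surjInv P.surjective_toFun (P.toFun z)) = σ z := fun z =>
    h _ _ (Function.surjInv_eq P.surjective_toFun _)
  refine ⟨fun q => σ (Function.surjInv P.surjective_toFun q), ?_, hs⟩
  have : CompactSpace Disc := isCompact_iff_compactSpace.1 (isCompact_closedBall _ _)
  have hq : Topology.IsQuotientMap P.toFun := P.continuous_toFun.isClosedMap.isQuotientMap
    P.continuous_toFun P.surjective_toFun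
  rw [hq.continuous_iff]
  exact hσ.congr fun z => (hs z).symm

/-- The polygon map lifts to coverings. -/
lemma exists_lift {E : Type*} [TopologicalSpace E] {π : E → S} (hπ : IsCoveringMap π)
    (hsurj : Function.Surjective π) :
    ∃ σ : Disc → E, Continuous σ ∧ ∀ z, π (σ z) = P.toFun z := by
  -- The radial contraction of the disc: the polygon map becomes the end of a homotopy starting at a
  -- constant map, which lifts by homotopy lifting.
  let m : unitInterval × Disc → Disc := fun x => ⟨(x.1 : ℝ) • (x.2 : ℂ), by
    rw [mem_closedBall_zero_iff, norm_smul, Real.norm_eq_abs, abs_of_nonneg x.1.2.1]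
    exact mul_le_one₀ x.1.2.2 (norm_nonneg _) (mem_closedBall_zero_iff.1 x.2.2)⟩
  have hm : Continuous m := by
    refine Continuous.subtype_mk ?_ _
    fun_prop
  let H : C(unitInterval × Disc, S) := ⟨fun x => P.toFun (m x), P.continuous_toFun.comp hm⟩
  obtain ⟨e₀, he₀⟩ := hsurj (P.toFun ⟨0, by simp⟩)
  have H0 : ∀ z, H (0, z) = π ((ContinuousMap.const Disc e₀) z) := by
    intro z
    simp [H, he₀, m]
  refine ⟨fun z => hπ.liftHomotopy H (ContinuousMap.const Disc e₀) H0 (1, z), by fun_prop, ?_⟩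
  intro z
  have := congrFun (hπ.liftHomotopy_lifts H (ContinuousMap.const Disc e₀) H0) (1, z)
  simpa [H, m] using this

end PolygonModel

/-! ### Gluing to a global region colouring. -/

namespace OrientedLink

universe u v

variable {S : Type u} [TopologicalSpace S] {n : ℕ} {L : OrientedLink S n}
  [ChartedSpace Plane S] {G : Type v} [Group G] [T2Space S] [IsManifold (𝓡 2) ∞ S]

lemma IsColoringAt.congr (hS : IsOrientedAtlas S) (hL : L.InGeneralPosition) {ρ : L.Arc → G}
    {f f' : S → G} {p : S} (h : L.IsColoringAt ρ f p)
    (he : ∀ᶠ y in 𝓝[L.underlyingGraphᶜ] p, f' y = f y) : L.IsColoringAt ρ f' p := by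
  refine ⟨fun hp => ?_, fun θ a h1 h2 h3 => ?_⟩
  · rw [L.isClosed_underlyingGraph.isOpen_compl.nhdsWithin_eq hp] at he
    filter_upwards [h.1 hp, he] with y e1 e2
    rw [e2, e1, he.self_of_nhds]
  · exact (h.2 θ a h1 h2 h3).congr 1 (by simpa [h1] using he)
      fun c t hct hc hne => eventually_notMem_of_transverse hS hL h2 hct hc hne

/-- Region colourings extend over the whole surface if the integrals of the arc colouring along
the sides of the polygon are trivial. -/
theorem exists_global_coloring [CompactSpace S] (hS : IsOrientedAtlas S)
    (hL : L.InGeneralPosition) {g : ℕ} (P : PolygonModel S g) (hLP : L.GeneralPositionWith P)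
    (φ : L.WirtingerGroup →* G)
    (hφ : ∀ j w, (L.IsIntegral (P.xLoop j) w ∨ L.IsIntegral (P.yLoop j) w) → φ w = 1) :
    ∃ f : S → G, ∀ p, L.IsColoringAt (fun a => φ (PresentedGroup.of a)) f p := by
  set ρ : L.Arc → G := fun a => φ (PresentedGroup.of a) with hρ
  have hρW : L.IsArcColoring ρ := by
    intro o u a b c ho ha hb hc
    have h : (PresentedGroup.mk L.wirtingerRels
        ((FreeGroup.of a * FreeGroup.of b) * (FreeGroup.of c * FreeGroup.of a)⁻¹)) = 1 :=
      PresentedGroup.one_of_mem ⟨o, u, a, b, c, ho, ha, hb, hc, rfl⟩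
    rw [map_mul, map_inv, mul_inv_eq_one, map_mul, map_mul] at h
    have := congrArg φ h
    rwa [map_mul, map_mul] at this
  obtain ⟨E, _, π, val, hπ, hsurj, hloc, hinj⟩ := exists_covering_of_isArcColoring hS hL hρW
  obtain ⟨σ, hσ, hπσ⟩ := P.exists_lift hπ hsurj
  -- Along any lift of a curve with trivial integral the germ value returns to its start. The lift
  -- itself need not be closed, so the jumps are compared with a local colouring at each crossing
  -- time.
  have hval : ∀ (c : ℝ → S), Continuous c → L.CurveInGeneralPosition c →
      (∀ w, L.IsIntegral c w → φ w = 1) → ∀ k : ℝ → E, Continuous k →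
      (∀ t ∈ Icc (0 : ℝ) 1, π (k t) = c t) → val (k 1) = val (k 0) := by
    intro c hc hgp hw k hk hπk
    obtain ⟨w, hcw⟩ := hgp.exists_isIntegral
    have h := hcw.eq_mul (ρ := ρ) φ (fun a => rfl) hc hgp (F := fun t => val (k t)) ?_ ?_
    · rwa [hw w hcw, mul_one] at h
    · intro t ht hct
      obtain ⟨f, hf, hev⟩ := hloc (k t)
      rw [hπk t ht] at hf
      have e1 := hc.continuousAt.eventually (hf.self_of_nhds.1 hct)
      have e2 := hc.continuousAt.eventually (L.isClosed_underlyingGraph.isOpen_compl.mem_nhds hct)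
      have e3 := hk.continuousAt.eventually hev
      have e4 := hev.self_of_nhds (by rwa [hπk t ht])
      rw [hπk t ht] at e4
      filter_upwards [nhdsWithin_le_nhds e1, nhdsWithin_le_nhds e2, nhdsWithin_le_nhds e3,
        self_mem_nhdsWithin] with s h1 h2 h3 hs
      rw [hπk s hs] at h3
      rw [h3 h2, h1, e4]
    · intro t ht hct
      obtain ⟨f, hf, hev⟩ := hloc (k t)
      rw [hπk t (Ioo_subset_Icc_self ht)] at hf
      refine ⟨f, hf.self_of_nhds, ?_⟩
      obtain ⟨θ, hθ⟩ := hct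
      obtain ⟨h1, h2⟩ := hgp.transverse t ht θ hθ
      have e3 := hk.continuousAt.eventually hev
      have e5 : ∀ᶠ s in 𝓝 t, s ∈ Ioo (0 : ℝ) 1 := isOpen_Ioo.mem_nhds ht
      filter_upwards [eventually_notMem_of_transverse hS hL h1 hθ.symm hc.continuousAt h2,
        nhdsWithin_le_nhds e3, nhdsWithin_le_nhds e5] with s h1 h2 h3
      rw [hπk s (Ioo_subset_Icc_self h3)] at h2
      exact h2 h1
  have hside : ∀ k, Continuous fun t => σ (sidePoint g k t) := fun k =>
    hσ.comp (continuous_sidePoint g k)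
  have hside' : ∀ k, Continuous fun t => σ (sidePoint g k (1 - t)) := fun k =>
    (hside k).comp (continuous_const.sub continuous_id)
  have hglue : ∀ z w, SideGlue g z w → σ z = σ w := by
    -- Two lifts of one side agree as soon as their initial germs have equal values, since the base
    -- point is off the graph and there the value determines the germ.
    have hlift : ∀ (c : ℝ → S), L.CurveInGeneralPosition c → ∀ k k' : ℝ → E, Continuous k →
        Continuous k' → (∀ t ∈ Icc (0 : ℝ) 1, π (k t) = c t) →
        (∀ t ∈ Icc (0 : ℝ) 1, π (k' t) = c t) → val (k 0) = val (k' 0) →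
        ∀ t ∈ Icc (0 : ℝ) 1, k t = k' t := by
      intro c hgp k k' hk hk' h1 h2 h0
      have m0 : (0 : ℝ) ∈ Icc (0 : ℝ) 1 := by simp
      refine hπ.eqOn_of_comp_eqOn isPreconnected_Icc hk.continuousOn hk'.continuousOn
        (fun t ht => (h1 t ht).trans (h2 t ht).symm) m0
        (hinj _ _ ((h1 0 m0).trans (h2 0 m0).symm) ?_ h0)
      rw [h1 0 m0]
      exact hgp.start_notMem
    -- Each side of a commutator block lifts some `x_j` or `y_j`, possibly reversed, so the germ
    -- value is the same at all vertices of the block.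
    have hverts : ∀ j, j < g →
        val (σ (sidePoint g (4 * j + 1) 0)) = val (σ (sidePoint g (4 * j) 0)) ∧
        val (σ (sidePoint g (4 * j + 2) 0)) = val (σ (sidePoint g (4 * j + 1) 0)) ∧
        val (σ (sidePoint g (4 * j + 2) 0)) = val (σ (sidePoint g (4 * j + 2) 1)) ∧
        val (σ (sidePoint g (4 * j + 3) 0)) = val (σ (sidePoint g (4 * j + 3) 1)) := by
      intro j hj
      have hx := hval (P.xLoop ⟨j, hj⟩) (P.continuous_xLoop _) (hLP ⟨j, hj⟩).1
        (fun w hw => hφ _ w (Or.inl hw))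
      have hy := hval (P.yLoop ⟨j, hj⟩) (P.continuous_yLoop _) (hLP ⟨j, hj⟩).2
        (fun w hw => hφ _ w (Or.inr hw))
      have h1 := hx _ (hside (4 * j)) fun t _ => hπσ _
      have h2 := hy _ (hside (4 * j + 1)) fun t _ => hπσ _
      have h3 := hx _ (hside' (4 * j + 2)) fun t ht => (hπσ _).trans (P.glue_x hj ht).symm
      have h4 := hy _ (hside' (4 * j + 3)) fun t ht => (hπσ _).trans (P.glue_y hj ht).symm
      rw [sidePoint_one] at h1 h2
      simp only [sub_self, sub_zero] at h3 h4
      exact ⟨h1, h2, h3, h4⟩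
    rintro z w (⟨j, hj, t, ht⟩ | ⟨j, hj, t, ht⟩ | ⟨hg, z, w, hz, hw⟩)
    · obtain ⟨h1, h2, h3, -⟩ := hverts j hj
      refine hlift _ (hLP ⟨j, hj⟩).1 _ _ (hside (4 * j)) (hside' (4 * j + 2)) (fun t _ => hπσ _)
        (fun t ht => (hπσ _).trans (P.glue_x hj ht).symm) ?_ t ht
      simp only [sub_zero]
      rw [← h3, h2, h1]
    · obtain ⟨h1, h2, h3, h4⟩ := hverts j hj
      refine hlift _ (hLP ⟨j, hj⟩).2 _ _ (hside (4 * j + 1)) (hside' (4 * j + 3))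
        (fun t _ => hπσ _) (fun t ht => (hπσ _).trans (P.glue_y hj ht).symm) ?_ t ht
      simp only [sub_zero]
      rw [← h4, ← h2, h3, sidePoint_one]
    · let b : ℝ → Disc := fun t =>
        ⟨(Circle.exp t : ℂ), mem_closedBall_zero_iff.2 (Circle.norm_coe _).le⟩
      have hb : Continuous b :=
        (continuous_subtype_val.comp Circle.exp.continuous).subtype_mk _
      have hsurjb : ∀ z : Disc, ‖(z : ℂ)‖ = 1 → ∃ t, b t = z := by
        intro z hz
        refine ⟨Complex.arg z, Subtype.ext ?_⟩
        simp only [b, Circle.coe_exp]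
        simpa [hz] using Complex.norm_mul_exp_arg_mul_I (z : ℂ)
      obtain ⟨t, rfl⟩ := hsurjb z hz
      obtain ⟨t', rfl⟩ := hsurjb w hw
      -- For the sphere the boundary circle maps to one point of `S`, so its lift stays in a
      -- discrete fibre and is constant.
      refine hπ.const_of_comp (hσ.comp hb) (fun s s' => ?_) t t'
      simp only [Function.comp_apply, hπσ]
      exact (P.eq_iff _ _).2 (.rel _ _ (.sphere hg _ _ (Circle.norm_coe _) (Circle.norm_coe _)))
  obtain ⟨s, hs, hsσ⟩ := P.exists_factor hσ hglue
  have hπs : ∀ p, π (s p) = p := by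
    intro p
    obtain ⟨z, rfl⟩ := P.surjective_toFun p
    rw [hsσ, hπσ]
  refine ⟨fun p => val (s p), fun p => ?_⟩
  obtain ⟨f, hf, hev⟩ := hloc (s p)
  rw [hπs] at hf
  refine hf.self_of_nhds.congr hS hL ?_
  have := hs.continuousAt.eventually hev
  filter_upwards [nhdsWithin_le_nhds this, self_mem_nhdsWithin] with q h1 h2
  rw [hπs] at h1
  exact h1 h2

end OrientedLink

end ThickenedSurface

/-! ### Uniqueness of colourings and the isomorphism. -/

namespace ThickenedSurface

namespace OrientedLink

variable {S : Type*} [TopologicalSpace S] {n : ℕ} {L : OrientedLink S n}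
  [ChartedSpace Plane S] {G : Type*} [Group G] [T2Space S] [IsManifold (𝓡 2) ∞ S]

/-- Every arc contains a point that is not a crossing. -/
lemma exists_isSimplePoint_onArc (hS : IsOrientedAtlas S) (hL : L.InGeneralPosition) (a : L.Arc) :
    ∃ θ, L.IsSimplePoint θ ∧ L.OnArc θ a := by
  obtain ⟨⟨θ, hθ⟩, rfl⟩ := ConnectedComponents.surjective_coe a
  obtain ⟨δ, hδ, hs⟩ := mem_nhdsGT_iff_exists_Ioo_subset.1
    (eventually_isSimplePoint_shift hS hL hθ)
  have hδ : (0 : ℝ) < δ := hδ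
  have hm : δ / 2 ∈ Ioo 0 δ := ⟨half_pos hδ, half_lt_self hδ⟩
  refine ⟨shift θ (δ / 2), hs hm, ?_⟩
  refine onArc_of_isPreconnected (isPreconnected_Ico (a := 0) (b := δ)) (fun t ht => ?_)
    (s := 0) ⟨le_rfl, hδ⟩ (Ioo_subset_Ico_self hm) ⟨by rwa [shift_zero], ?_⟩
  · rcases ht.1.eq_or_lt with rfl | h
    · rwa [shift_zero]
    · exact IsSimplePoint.not_isUnder (hs ⟨h, ht.2⟩)
  · simp only [shift_zero]

/-- Two region colourings for the same arc colouring agree if they agree at one point. -/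
lemma eq_of_isColoringAt [ConnectedSpace S] (hS : IsOrientedAtlas S) (hL : L.InGeneralPosition)
    {ρ : L.Arc → G} {f f' : S → G} (hf : ∀ p, L.IsColoringAt ρ f p)
    (hf' : ∀ p, L.IsColoringAt ρ f' p) {p₀ : S} (hp₀ : p₀ ∉ L.underlyingGraph)
    (h₀ : f' p₀ = f p₀) {p : S} (hp : p ∉ L.underlyingGraph) : f' p = f p := by
  choose g hg using fun p => exists_mul_eq_of_isColoringAt hS hL (p := p)
    (Eventually.of_forall hf) (Eventually.of_forall hf')
  have hne : ∀ p, (𝓝[L.underlyingGraphᶜ] p).NeBot := dense_compl_underlyingGraph hS hL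
  -- The ratio of the two colourings is locally constant on a connected surface, so its value `1` at
  -- `p₀` spreads everywhere.
  have hloc : IsLocallyConstant g := by
    rw [IsLocallyConstant.iff_eventually_eq]
    intro p
    filter_upwards [eventually_eventually_nhds.2 (eventually_nhdsWithin_iff.1 (hg p))] with q hq
    obtain ⟨y, h1, h2⟩ := ((hg q).and (eventually_nhdsWithin_iff.2 hq)).exists
    exact mul_right_cancel (h1.symm.trans h2)
  have e0 := (hg p₀).self_of_nhdsWithin hp₀
  have e1 := (hg p).self_of_nhdsWithin hp
  rw [h₀, right_eq_mul] at e0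
  rw [e1, hloc.apply_eq_of_preconnectedSpace p p₀, e0, one_mul]

/-- The Dehn link group is the quotient of the Wirtinger link group by the surface subgroup. -/
theorem exists_dehnGroup_mulEquiv {S : Type*} [TopologicalSpace S] [T2Space S] [CompactSpace S]
    [ConnectedSpace S] [ChartedSpace Plane S] [IsManifold (𝓡 2) ∞ S]
    (hS : IsOrientedAtlas S)
    {g : ℕ} (P : PolygonModel S g)
    {n : ℕ} (L : OrientedLink S n) (hL : L.InGeneralPosition)
    (hLP : L.GeneralPositionWith P) (R₀ : L.Region) :
    ∃ φ : L.DehnGroup R₀ ≃* L.WirtingerGroup ⧸ L.surfaceSubgroup P,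
      ∀ (θ : Fin n × UnitAddCircle) (a : L.Arc) (v : Plane) (A B : L.Region),
        L.IsSimplePoint θ → L.OnArc θ a → 0 < cross (L.velocity θ) v →
        L.RegionNext (L.proj θ) (-v) A → L.RegionNext (L.proj θ) v B →
        φ ((PresentedGroup.of A)⁻¹ * PresentedGroup.of B) =
          QuotientGroup.mk (PresentedGroup.of a) := by
  -- the region colouring with values in the quotient of the Wirtinger group
  set Q := L.WirtingerGroup ⧸ L.surfaceSubgroup P
  set ρ : L.Arc → Q := fun a => QuotientGroup.mk' (L.surfaceSubgroup P) (PresentedGroup.of a)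
    with hρ
  obtain ⟨f, hf⟩ := exists_global_coloring hS hL P hLP (QuotientGroup.mk' (L.surfaceSubgroup P))
    (fun j w hw => (QuotientGroup.eq_one_iff w).2 (Subgroup.subset_normalClosure ⟨j, hw⟩))
  have hrep : ∀ R : L.Region, ∃ q, L.InRegion q R := by
    intro R
    obtain ⟨⟨q, hq⟩, rfl⟩ := ConnectedComponents.surjective_coe R
    exact ⟨q, hq, rfl⟩
  choose rep hrep using hrep
  -- Normalizing by a left factor makes the base region trivial and leaves all jumps unchanged.
  set x : L.Region → Q := fun R => (f (rep R₀))⁻¹ * f (rep R) with hx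
  have hx₀ : x R₀ = 1 := by simp [hx]
  have hxcol : ∀ p, L.IsColoringAt ρ (fun q => x (L.regionOf R₀ q)) p := by
    intro p
    refine ((hf p).mul_left (f (rep R₀))⁻¹).congr hS hL ?_
    filter_upwards [self_mem_nhdsWithin] with q hq
    simp only [hx]
    rw [eq_of_inRegion (fun q => (hf q).1) (hrep _) (inRegion_regionOf hq)]
  have hxrel := isRegionColoring_of_isColoringAt hS hL hxcol
  have hφ : ∀ r ∈ L.crossingRels ∪ {FreeGroup.of R₀}, FreeGroup.lift x r = 1 := by
    rintro r (⟨o, u, A, B, C, D, ho, hA, hB, hC, hD, rfl⟩ | rfl)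
    · simp only [map_mul, map_inv, FreeGroup.lift_apply_of]
      rw [hxrel o u A B C D ho hA hB hC hD, mul_inv_cancel]
    · simpa using hx₀
  let φ : L.DehnGroup R₀ →* Q := PresentedGroup.toGroup hφ
  have hφof : ∀ A, φ (PresentedGroup.of A) = x A := fun A => PresentedGroup.toGroup.of hφ
  -- the arc colouring with values in the Dehn group
  let y : L.Region → L.DehnGroup R₀ := PresentedGroup.of
  have hy₀ : y R₀ = 1 := PresentedGroup.one_of_mem (Or.inr rfl)
  have hyrel : L.IsRegionColoring y := by
    intro o u A B C D ho hA hB hC hD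
    have h : PresentedGroup.mk (L.crossingRels ∪ {FreeGroup.of R₀})
        (((FreeGroup.of A)⁻¹ * FreeGroup.of B) * ((FreeGroup.of C)⁻¹ * FreeGroup.of D)⁻¹) = 1 :=
      PresentedGroup.one_of_mem (Or.inl ⟨o, u, A, B, C, D, ho, hA, hB, hC, hD, rfl⟩)
    rwa [map_mul, map_inv, mul_inv_eq_one, map_mul, map_mul, map_inv, map_inv] at h
  obtain ⟨η, hη⟩ := hyrel.exists_arc_coloring hS hL R₀
  have hηrel := isArcColoring_of_isColoringAt hS hL hη
  have hψ₀ : ∀ r ∈ L.wirtingerRels, FreeGroup.lift η r = 1 := by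
    rintro r ⟨o, u, a, b, c, ho, ha, hb, hc, rfl⟩
    simp only [map_mul, map_inv, FreeGroup.lift_apply_of]
    rw [hηrel o u a b c ho ha hb hc, mul_inv_cancel]
  let ψ₀ : L.WirtingerGroup →* L.DehnGroup R₀ := PresentedGroup.toGroup hψ₀
  have hψ₀of : ∀ a, ψ₀ (PresentedGroup.of a) = η a := fun a => PresentedGroup.toGroup.of hψ₀
  -- The tautological region colouring in the Dehn group is single-valued on `S`, so its ratio along
  -- a closed curve, the image of the integral, is trivial.
  have hint : ∀ c : ℝ → S, Continuous c → L.CurveInGeneralPosition c → c 1 = c 0 →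
      ∀ w, L.IsIntegral c w → ψ₀ w = 1 := by
    intro c hc hgp hcl w hw
    have h := hw.eq_mul ψ₀ hψ₀of hc hgp (F := fun t => y (L.regionOf R₀ (c t)))
      (fun t _ ht => nhdsWithin_le_nhds (hc.continuousAt.eventually ((hη (c t)).1 ht)))
      (fun t _ _ => ⟨_, hη (c t), Eventually.of_forall fun _ => rfl⟩)
    rw [hcl] at h
    exact left_eq_mul.1 h
  have hker : L.surfaceSubgroup P ≤ ψ₀.ker := by
    refine Subgroup.normalClosure_le_normal ?_
    rintro w ⟨j, hw | hw⟩
    · exact hint _ (P.continuous_xLoop j) (hLP j).1 (P.xLoop_closed j) w hw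
    · exact hint _ (P.continuous_yLoop j) (hLP j).2 (P.yLoop_closed j) w hw
  let ψ : Q →* L.DehnGroup R₀ := QuotientGroup.lift _ ψ₀ hker
  have hψof : ∀ a, ψ (ρ a) = η a := fun a => hψ₀of a
  -- Both sides are region colourings for `η` that are trivial on `R₀`, so they agree on every
  -- region.
  have hψx : ∀ A, ψ (x A) = y A := by
    intro A
    have h1 : ∀ p, L.IsColoringAt η (fun q => ψ (x (L.regionOf R₀ q))) p := by
      intro p
      simpa only [hψof] using (hxcol p).map ψ
    have h := eq_of_isColoringAt hS hL hη h1 (hrep R₀).1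
      (by simp only [(hrep R₀).regionOf_eq, hx₀, hy₀, map_one]) (hrep A).1
    simpa only [(hrep A).regionOf_eq] using h
  -- The colouring `x` is the image of the tautological one under `φ`; its jump at a simple point of
  -- `a` is therefore both `φ (η a)` and `ρ a`.
  have hφη : ∀ a, φ (η a) = ρ a := by
    intro a
    obtain ⟨θ, hθ, ha⟩ := exists_isSimplePoint_onArc hS hL a
    have h := ((hη (L.proj θ)).2 θ a rfl hθ ha).map φ
    simp only [y, hφof] at h
    exact h.unique hL ((hxcol (L.proj θ)).2 θ a rfl hθ ha)
  have h1 : ψ.comp φ = MonoidHom.id _ := by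
    refine PresentedGroup.ext fun A => ?_
    rw [MonoidHom.comp_apply, hφof, hψx]; rfl
  have h2 : φ.comp ψ = MonoidHom.id _ := by
    refine QuotientGroup.monoidHom_ext _ (PresentedGroup.ext fun a => ?_)
    exact (congrArg φ (hψof a)).trans (hφη a)
  refine ⟨MonoidHom.toMulEquiv φ ψ h1 h2, fun θ a v A B hθ ha hv hA hB => ?_⟩
  change φ ((PresentedGroup.of A)⁻¹ * PresentedGroup.of B) = ρ a
  rw [map_mul, map_inv, hφof, hφof]
  obtain ⟨k, e1, e2⟩ := (hxcol (L.proj θ)).2 θ a rfl hθ ha (line (L.proj θ) v) 0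
    (line_zero _ _) (continuousAt_line _ _) (by rwa [curveVelocity_line])
  -- The region met in the direction `-v` is the one on the line through the point with velocity `v`
  -- at small negative times.
  have hneg : ∀ᶠ ε : ℝ in 𝓝[>] 0, x (L.regionOf R₀ (line (L.proj θ) v (-ε))) = k := by
    have : Tendsto (fun s : ℝ => -s) (𝓝[>] 0) (𝓝[<] 0) := by
      simpa using tendsto_neg_nhdsGT (a := (0 : ℝ))
    exact this.eventually e1
  obtain ⟨ε, hε, hεA⟩ := (hneg.and hA).exists
  obtain ⟨ε', hε', hεB⟩ := (e2.and hB).exists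
  have hεA' : L.InRegion (line (L.proj θ) v (-ε)) A := by
    simpa [line] using hεA
  rw [hεA'.regionOf_eq] at hε
  have hεB' : x (L.regionOf R₀ (line (L.proj θ) v ε')) = k * ρ a := hε'
  rw [InRegion.regionOf_eq (q := line (L.proj θ) v ε') hεB] at hεB'
  rw [hε, hεB', inv_mul_cancel_left]

end OrientedLink

end ThickenedSurface

end

theorem mainTheorem1 {S : Type*} [TopologicalSpace S] [T2Space S] [CompactSpace S]
    [ConnectedSpace S] [ChartedSpace ThickenedSurface.Plane S] [IsManifold (𝓡 2) ∞ S]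
    (hS : ThickenedSurface.IsOrientedAtlas S)
    {g : ℕ} (P : ThickenedSurface.PolygonModel S g)
    {n : ℕ} (L : ThickenedSurface.OrientedLink S n) (hL : L.InGeneralPosition)
    (hLP : L.GeneralPositionWith P) (R₀ : L.Region) :
    ∃ φ : L.DehnGroup R₀ ≃* L.WirtingerGroup ⧸ L.surfaceSubgroup P,
      ∀ (θ : Fin n × UnitAddCircle) (a : L.Arc) (v : ThickenedSurface.Plane) (A B : L.Region),
        L.IsSimplePoint θ → L.OnArc θ a → 0 < ThickenedSurface.cross (L.velocity θ) v →
        L.RegionNext (L.proj θ) (-v) A → L.RegionNext (L.proj θ) v B →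
        φ ((PresentedGroup.of A)⁻¹ * PresentedGroup.of B) =
          QuotientGroup.mk (PresentedGroup.of a) :=
  ThickenedSurface.OrientedLink.exists_dehnGroup_mulEquiv hS P L hL hLP R₀
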